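/- Let $\psi(q)=\sum_{j=0}^{\infty}q^{j(j+1)/2}$, so that $\psi(-q)=\sum_{j=0}^{\infty}(-q)^{j(j+1)/2}$, and let the integers $\overline{b}_5(n)$, $n\ge 0$, be defined by the power series identity $$\sum_{n=0}^{\infty}\overline{b}_5(n)q^n=\frac{\psi^5(-q^5)}{\psi(-q)},$$ where $\psi(-q^5)$ denotes $\psi(-q)$ with $q$ replaced by $q^5$. Then for every nonnegative integer $n$ and every integer $k\ge 2$, $$\overline{b}_5(4n+3)=2\,\overline{b}_5(2n)$$ and $$\overline{b}_5\bigl(5^k(n+3)-3\bigr)=\left(\frac{5^k-1}{4}\right)\overline{b}_5(5n+12)-\left(\frac{5^k-5}{4}\right)\overline{b}_5(n).$$ -/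

import Mathlib

/-- Ramanujan's theta function `ψ(q) = ∑_{j ≥ 0} q^{j(j+1)/2}`, as a formal power series in `q`
(the coefficient of `q^m` counts the `j ≥ 0` with `j(j+1)/2 = m`; such `j` satisfy `j ≤ m`). -/
noncomputable def thetaPsi : PowerSeries ℤ :=
  PowerSeries.mk fun m => ∑ j ∈ Finset.range (m + 1), if j * (j + 1) / 2 = m then 1 else 0

/-- The series `ψ(-q) = ∑_{j ≥ 0} (-q)^{j(j+1)/2}`. -/
noncomputable def thetaPsiNeg : PowerSeries ℤ :=
  PowerSeries.rescale (-1) thetaPsi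

/-- The quotient `ψ⁵(-q⁵) / ψ(-q)` in `ℤ⟦q⟧`. Here `ψ(-q⁵)` is `ψ(-q)` with `q` replaced by `q⁵`,
and `ψ(-q)` has constant coefficient `1`, so it is invertible. -/
noncomputable def bBarFiveSeries : PowerSeries ℤ :=
  (PowerSeries.expand 5 (by norm_num) thetaPsiNeg) ^ 5 * PowerSeries.invOfUnit thetaPsiNeg 1

/-- The function `b̄₅(n)`, given by `∑ b̄₅(n) qⁿ = ψ⁵(-q⁵) / ψ(-q)`. -/
noncomputable def bBarFive (n : ℕ) : ℤ :=
  PowerSeries.coeff n bBarFiveSeries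

theorem constantCoeff_thetaPsiNeg : PowerSeries.constantCoeff thetaPsiNeg = 1 := by
  rw [← PowerSeries.coeff_zero_eq_constantCoeff_apply]
  rw [thetaPsiNeg, PowerSeries.coeff_rescale, thetaPsi, PowerSeries.coeff_mk]
  decide

/-- The series really is the quotient. -/
theorem bBarFiveSeries_mul_thetaPsiNeg :
    bBarFiveSeries * thetaPsiNeg = (PowerSeries.expand 5 (by norm_num) thetaPsiNeg) ^ 5 := by
  rw [bBarFiveSeries, mul_assoc,
    PowerSeries.invOfUnit_mul _ _ (by simpa using constantCoeff_thetaPsiNeg), mul_one]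

/-!
# The coefficients of `ψ⁵(-q⁵) / ψ(-q)`

Write `P = ψ(q)`, `C = ψ(q⁵)`, `A = f(q²,q³)`, `B = f(q,q⁴)`, `E_d = ∏ (1 - q^(dn))`, and consider
`W = q³ C⁵ / P` (`psiQuotient`). Its coefficient of `q^(n+3)` is `(-1)ⁿ b̄₅(n)`, so the theorem is a
statement about the action on `W` of the operators `U₅` and `U₂` (`multisection`). All series are
taken in `ℂ⟦q⟧`.

*Powers of 5.* Splitting the summation index modulo 5 gives `P = A(q⁵) + q B(q⁵) + q³ C(q⁵)`
(`psi_dissection`). The product of the five series `P(ωʲ q)`, `ω⁵ = 1`, is on the one hand the norm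
form of this trinomial and on the other hand, by Gauss's product `P = E₂² / E₁`, equal to
`ψ(q⁵)⁶ / ψ(q²⁵)`. This gives an expression for `1 / P` as a polynomial in the components, so that
`U₅ W` can be read off; together with `AB = P² - q C²` (`psi_sq`) one finds that `W`, `q P³ C` and
`q² P C³` span a space stable under `U₅`, with
`U₅ W = q P³ C - 5 q² P C³ + 5 W`, `U₅ (q P³ C) = 6 q P³ C - 5 q² P C³`, `U₅ (q² P C³) = q P³ C`.
Hence `(U₅ - 1)(U₅ - 5) W = 0` (`multisection_multisection_psiQuotient`), and the second claim
is the solution of this linear recurrence.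

*The prime 2.* By `AB = P² - q C²` and the product formulas, `q² P C³ - W = q² E₁₀⁵ / E₂`, which is
an even function (`exists_expand_two_eq`). The identity
`W(q) + W(-q) = -2 (q² P C³ + W)(q²)` (`psiQuotient_add_rescale`) then says that the coefficient of
`q^(2m)` in `W` is `-2` times that of `q^m` for odd `m`. This identity follows, by algebra in the
`E_d`, from `AB = P² - q C²` and its analogue `φ(q)² - φ(q⁵)² = 4 q f(q,q⁹) f(q³,q⁷)`.

The two quadratic identities come from splitting the lattice of pairs `(x, y)` according to
`2x + y` modulo 5, that is, from multiplication by `2 + i` on Gaussian integers. The passage from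
theta series to products is the Jacobi triple product (`theta_eq_prod`), obtained as a limit of its
finite form with Gaussian binomial coefficients.
-/

open PowerSeries Filter Topology
open scoped PowerSeries.WithPiTopology

namespace ThetaQuotient

/-! ### Gaussian binomial coefficients -/

section Gauss
variable {R : Type*} [CommRing R]

/-- The Gaussian binomial coefficient `[n choose k]_Q`, by its Pascal recursion. -/
def gaussBinom (Q : R) : ℕ → ℕ → R
  | _, 0 => 1
  | 0, _ + 1 => 0
  | n + 1, k + 1 => gaussBinom Q n k + Q ^ (k + 1) * gaussBinom Q n (k + 1)

theorem gaussBinom_zero_right (Q : R) (n : ℕ) : gaussBinom Q n 0 = 1 := by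
  cases n <;> rfl

theorem gaussBinom_succ_succ (Q : R) (n k : ℕ) :
    gaussBinom Q (n + 1) (k + 1) = gaussBinom Q n k + Q ^ (k + 1) * gaussBinom Q n (k + 1) := rfl

theorem gaussBinom_of_lt (Q : R) : ∀ {n k : ℕ}, n < k → gaussBinom Q n k = 0
  | 0, _ + 1, _ => rfl
  | n + 1, k + 1, h => by
    rw [gaussBinom_succ_succ, gaussBinom_of_lt Q (by omega : n < k),
      gaussBinom_of_lt Q (by omega : n < k + 1)]
    simp

theorem gaussBinom_self (Q : R) (n : ℕ) : gaussBinom Q n n = 1 := by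
  induction n with
  | zero => rfl
  | succ n ih => rw [gaussBinom_succ_succ, ih, gaussBinom_of_lt Q (Nat.lt_succ_self n)]; simp

/-- The second Pascal recursion. -/
theorem gaussBinom_succ_succ' (Q : R) (n k : ℕ) (h : k ≤ n) :
    gaussBinom Q (n + 1) (k + 1) = gaussBinom Q n (k + 1) + Q ^ (n - k) * gaussBinom Q n k := by
  induction n generalizing k with
  | zero =>
    obtain rfl : k = 0 := by omega
    simp [gaussBinom]
  | succ n ih =>
    rcases Nat.lt_or_ge k (n + 1) with hk | hk
    · have h1 := ih k (by omega)
      rw [gaussBinom_succ_succ]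
      cases k with
      | zero =>
        have e1 := gaussBinom_succ_succ Q n 0
        simp only [gaussBinom_zero_right, Nat.sub_zero, zero_add, pow_one] at h1 e1 ⊢
        linear_combination Q * h1 - e1
      | succ k =>
        have h2 := ih k (by omega)
        have e1 := gaussBinom_succ_succ Q n k
        have e2 := gaussBinom_succ_succ Q n (k + 1)
        have p1 : n - k = (n - (k + 1)) + 1 := by omega
        have p2 : n + 1 - (k + 1) = (n - (k + 1)) + 1 := by omega
        rw [p1] at h2
        rw [p2]
        linear_combination Q ^ (k + 2) * h1 + h2 - e2 - Q ^ (n - (k + 1) + 1) * e1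
    · obtain rfl : k = n + 1 := by omega
      rw [gaussBinom_self, gaussBinom_self, gaussBinom_of_lt Q (Nat.lt_succ_self (n + 1))]
      simp

/-- The quotient formula for `[n+k choose k]_Q`, cleared of denominators. -/
theorem gaussBinom_add_mul (Q : R) (n k : ℕ) :
    gaussBinom Q (n + k) k * (∏ i ∈ Finset.range k, (1 - Q ^ (i + 1))) *
      (∏ i ∈ Finset.range n, (1 - Q ^ (i + 1))) = ∏ i ∈ Finset.range (n + k), (1 - Q ^ (i + 1)) := by
  induction k generalizing n with
  | zero => simp [gaussBinom_zero_right]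
  | succ k ihk =>
    induction n with
    | zero => simp [gaussBinom_self]
    | succ n ihn =>
      have h1 := ihk (n + 1)
      rw [show n + 1 + (k + 1) = (n + k + 1) + 1 by ring, gaussBinom_succ_succ]
      rw [show n + (k + 1) = n + k + 1 by ring] at ihn
      rw [show n + 1 + k = n + k + 1 by ring] at h1
      simp only [Finset.prod_range_succ] at h1 ihn ⊢
      linear_combination (1 - Q ^ (k + 1)) * h1 + Q ^ (k + 1) * (1 - Q ^ (n + 1)) * ihn

/-- A finite form of the Jacobi triple product: `t k` plays the role of `a ^ k * Q ^ (k(k-1)/2)`. -/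
theorem prod_mul_prod_eq_sum_gaussBinom (a b Q : R) (hQ : a * b = Q) (t : ℤ → R)
    (h0 : t 0 = 1) (hpos : ∀ k : ℕ, t (k + 1) = t k * a * Q ^ k)
    (hneg : ∀ k : ℕ, t (-(k + 1)) = t (-k) * b * Q ^ k) (M N : ℕ) :
    (∏ i ∈ Finset.range M, (1 + a * Q ^ i)) * ∏ i ∈ Finset.range N, (1 + b * Q ^ i) =
      ∑ j ∈ Finset.range (M + N + 1), gaussBinom Q (M + N) j * t (j - N) := by
  have up (M N j : ℕ) (hj : j ≤ M + N) :
      t ((j : ℤ) - N) * a * Q ^ M = t ((j + 1 : ℕ) - N : ℤ) * Q ^ (M + N - j) := by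
    rcases le_or_gt N j with h | h
    · obtain ⟨k, rfl⟩ := Nat.exists_eq_add_of_le h
      rw [show ((N + k : ℕ) : ℤ) - N = k by push_cast; ring,
        show ((N + k + 1 : ℕ) : ℤ) - N = k + 1 by push_cast; ring, hpos, mul_assoc, mul_assoc,
        mul_assoc, ← pow_add]
      congr 3; omega
    · obtain ⟨k, rfl⟩ := Nat.exists_eq_add_of_lt h
      rw [show ((j : ℕ) : ℤ) - (j + k + 1 : ℕ) = -(k + 1) by push_cast; ring,
        show ((j + 1 : ℕ) : ℤ) - (j + k + 1 : ℕ) = -k by push_cast; ring, hneg,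
        show M + (j + k + 1) - j = M + k + 1 by omega]
      rw [pow_add, pow_add, pow_one, ← hQ]
      ring
  have down (N j : ℕ) :
      t ((j : ℤ) - N) * b * Q ^ N = t ((j : ℤ) - (N + 1 : ℕ)) * Q ^ j := by
    rcases le_or_gt j N with h | h
    · obtain ⟨k, rfl⟩ := Nat.exists_eq_add_of_le h
      rw [show ((j : ℕ) : ℤ) - (j + k : ℕ) = -k by push_cast; ring,
        show ((j : ℕ) : ℤ) - (j + k + 1 : ℕ) = -(k + 1) by push_cast; ring, hneg, pow_add]
      ring
    · obtain ⟨k, rfl⟩ := Nat.exists_eq_add_of_lt h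
      rw [show ((N + k + 1 : ℕ) : ℤ) - N = k + 1 by push_cast; ring,
        show ((N + k + 1 : ℕ) : ℤ) - (N + 1 : ℕ) = k by push_cast; ring, hpos,
        pow_add, pow_add, pow_one, ← hQ]
      ring
  have hN : ∏ i ∈ Finset.range N, (1 + b * Q ^ i) =
      ∑ j ∈ Finset.range (N + 1), gaussBinom Q N j * t (j - N) := by
    induction N with
    | zero => simp [gaussBinom, h0]
    | succ N ih =>
      rw [Finset.prod_range_succ, ih, mul_add, mul_one, Finset.sum_range_succ' _ (N + 1)]
      have e1 : ∀ j ∈ Finset.range (N + 1),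
          gaussBinom Q (N + 1) (j + 1) * t ((j + 1 : ℕ) - (N + 1 : ℕ) : ℤ) =
          gaussBinom Q N j * t (j - N) +
            gaussBinom Q N (j + 1) * (t (((j + 1 : ℕ) : ℤ) - N) * b * Q ^ N) := by
        intro j _
        rw [down, gaussBinom_succ_succ]
        push_cast
        rw [show (j : ℤ) + 1 - (N + 1) = j - N by ring]
        ring
      rw [Finset.sum_congr rfl e1, Finset.sum_add_distrib, add_assoc]
      congr 1
      have e2 := Finset.sum_range_succ' (fun j => gaussBinom Q N j * (t ((j : ℤ) - N) * b * Q ^ N))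
        (N + 1)
      rw [Finset.sum_range_succ, gaussBinom_of_lt Q (Nat.lt_succ_self N), zero_mul, add_zero] at e2
      rw [Finset.sum_mul]
      have e3 := down N 0
      rw [pow_zero, mul_one] at e3
      rw [e3, gaussBinom_zero_right] at e2
      rw [gaussBinom_zero_right, ← e2]
      exact Finset.sum_congr rfl fun j _ => by ring
  induction M with
  | zero => simpa using hN
  | succ M ih =>
    rw [Finset.prod_range_succ, mul_right_comm, ih, mul_add, mul_one,
      show M + 1 + N = M + N + 1 by ring, Finset.sum_range_succ' _ (M + N + 1)]
    have e1 : ∀ j ∈ Finset.range (M + N + 1),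
        gaussBinom Q (M + N + 1) (j + 1) * t ((j + 1 : ℕ) - N : ℤ) =
        gaussBinom Q (M + N) (j + 1) * t ((j + 1 : ℕ) - N : ℤ) +
          gaussBinom Q (M + N) j * (t ((j : ℤ) - N) * a * Q ^ M) := by
      intro j hj
      have hj' : j ≤ M + N := by simpa [Nat.lt_succ_iff] using hj
      rw [up M N j hj', gaussBinom_succ_succ' Q _ _ hj']
      ring
    rw [Finset.sum_congr rfl e1, Finset.sum_add_distrib,
      add_right_comm (G := R)]
    congr 1
    · have e2 := Finset.sum_range_succ' (fun j => gaussBinom Q (M + N) j * t ((j : ℤ) - N))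
        (M + N + 1)
      rw [Finset.sum_range_succ, gaussBinom_of_lt Q (Nat.lt_succ_self (M + N)), zero_mul,
        add_zero] at e2
      rw [e2, gaussBinom_zero_right, gaussBinom_zero_right]
    · rw [Finset.sum_mul]
      exact Finset.sum_congr rfl fun j _ => by ring

end Gauss

/-! ### Infinite products of power series -/

/-- The convergence criterion used for all products below. -/
theorem multipliable_of_X_pow_dvd {f : ℕ → ℂ⟦X⟧} (h : ∀ i, X ^ i ∣ f i - 1) : Multipliable f := by
  have : f = (1 + (f · - 1)) := by ext1 i; simp
  rw [this]
  apply WithPiTopology.multipliable_one_add_of_tendsto_order_atTop_nhds_top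
  refine ENat.tendsto_nhds_top_iff_natCast_lt.mpr fun n => eventually_atTop.mpr ⟨n + 1, ?_⟩
  intro i hi
  refine lt_of_lt_of_le (by exact_mod_cast Nat.lt_succ_self n) (nat_le_order _ (n + 1) fun k hk => ?_)
  exact X_pow_dvd_iff.mp (h i) k (by omega)

theorem X_pow_dvd_one_sub {i n : ℕ} (h : i ≤ n) : (X : ℂ⟦X⟧) ^ i ∣ (1 - X ^ n) - 1 := by
  rw [show (1 - (X : ℂ⟦X⟧) ^ n) - 1 = -X ^ n by ring, dvd_neg]
  exact pow_dvd_pow _ h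

theorem X_pow_dvd_one_add {i n : ℕ} (h : i ≤ n) : (X : ℂ⟦X⟧) ^ i ∣ (1 + X ^ n) - 1 := by
  rw [add_sub_cancel_left]
  exact pow_dvd_pow _ h

theorem X_pow_dvd_ite {i : ℕ} {p : Prop} [Decidable p] {f : ℂ⟦X⟧} (h : X ^ i ∣ f - 1) :
    X ^ i ∣ (if p then f else 1) - 1 := by
  split_ifs
  · exact h
  · simp

/-- Reindexing a product along an arithmetic progression. -/
theorem tprod_arith (d c : ℕ) (hc : c < d) (g : ℕ → ℂ⟦X⟧) :
    ∏' i, g (d * i + c) = ∏' n, if n % d = c then g n else 1 := by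
  have hinj : Function.Injective (fun i => d * i + c) := fun i j h => by
    have : d * i = d * j := by simpa using h
    exact Nat.eq_of_mul_eq_mul_left (by omega) this
  have := hinj.tprod_eq (f := fun n => if n % d = c then g n else 1) (by
    intro n hn
    by_cases h : n % d = c
    · exact ⟨n / d, by simp only; rw [← h]; exact Nat.div_add_mod n d⟩
    · simp [h] at hn)
  rw [← this]
  congr 1 with i
  simp [Nat.add_mod, Nat.mod_eq_of_lt hc]

/-- The product `∏_{n ≥ 1} (1 - q^(d n))`. -/
noncomputable def euler (d : ℕ) : ℂ⟦X⟧ := ∏' i : ℕ, (1 - X ^ (d * (i + 1)))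

/-- The product `∏_{i ≥ 0} (1 + q^(s + m i))`. -/
noncomputable def plusProd (s m : ℕ) : ℂ⟦X⟧ := ∏' i : ℕ, (1 + X ^ (s + m * i))

theorem multipliable_euler {d : ℕ} (hd : d ≠ 0) :
    Multipliable fun i : ℕ => (1 - X ^ (d * (i + 1)) : ℂ⟦X⟧) :=
  multipliable_of_X_pow_dvd fun i => X_pow_dvd_one_sub (by nlinarith [Nat.pos_of_ne_zero hd])

theorem multipliable_plusProd (s : ℕ) {m : ℕ} (hm : m ≠ 0) :
    Multipliable fun i : ℕ => (1 + X ^ (s + m * i) : ℂ⟦X⟧) :=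
  multipliable_of_X_pow_dvd fun i => X_pow_dvd_one_add (by nlinarith [Nat.pos_of_ne_zero hm])

/-- `∏_{n ≥ 1} (1 - q^(dcn))` as a product over all `n`, the factors with `d ∤ n` being trivial. -/
theorem euler_mul_eq_tprod_ite (d c : ℕ) (hd : d ≠ 0) :
    euler (c * d) = ∏' n : ℕ, if d ∣ n + 1 then (1 - X ^ (c * (n + 1)) : ℂ⟦X⟧) else 1 := by
  have := tprod_arith d (d - 1) (by omega) (fun n => (1 - X ^ (c * (n + 1)) : ℂ⟦X⟧))
  rw [euler]
  convert this using 3 with i n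
  · have : d * i + (d - 1) + 1 = d * (i + 1) := by rw [mul_add]; omega
    rw [this, mul_assoc]
  · refine if_congr ⟨fun h => ?_, fun h => ?_⟩ rfl rfl
    · obtain ⟨k, hk⟩ := h
      cases k with
      | zero => omega
      | succ k =>
        have : n = d - 1 + d * k := by rw [mul_add] at hk; omega
        rw [this, Nat.add_mul_mod_self_left, Nat.mod_eq_of_lt (by omega)]
    · refine ⟨n / d + 1, ?_⟩
      have := Nat.div_add_mod n d
      rw [mul_add]; omega

theorem constantCoeff_tprod {f : ℕ → ℂ⟦X⟧} (hf : Multipliable f)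
    (h : ∀ i, constantCoeff (f i) = 1) : constantCoeff (∏' i, f i) = 1 := by
  rw [hf.map_tprod (constantCoeff (R := ℂ)) (WithPiTopology.continuous_constantCoeff ℂ)]
  simp [h]

theorem constantCoeff_euler {d : ℕ} (hd : d ≠ 0) : constantCoeff (euler d) = 1 := by
  refine constantCoeff_tprod (multipliable_euler hd) fun i => ?_
  have : d * (i + 1) ≠ 0 := by positivity
  simp [this]

theorem euler_ne_zero {d : ℕ} (hd : d ≠ 0) : euler d ≠ 0 := fun h => by
  have := constantCoeff_euler hd
  simp [h] at this

theorem continuous_of_coeff {F : ℂ⟦X⟧ → ℂ⟦X⟧} (h : ∀ d, Continuous fun f => coeff d (F f)) :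
    Continuous F :=
  continuous_iff_continuousAt.2 fun x =>
    (WithPiTopology.tendsto_iff_coeff_tendsto ℂ F _ _).2 fun d => (h d).tendsto x

theorem continuous_rescale (a : ℂ) : Continuous (rescale a : ℂ⟦X⟧ →+* ℂ⟦X⟧) :=
  continuous_of_coeff fun d => by
    simp_rw [coeff_rescale]
    exact continuous_const.mul (WithPiTopology.continuous_coeff ℂ d)

theorem continuous_expand (d : ℕ) (hd : d ≠ 0) :
    Continuous (expand d hd : ℂ⟦X⟧ →ₐ[ℂ] ℂ⟦X⟧) :=
  continuous_of_coeff fun n => by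
    by_cases h : d ∣ n
    · obtain ⟨k, rfl⟩ := h
      simp_rw [coeff_expand_mul]
      exact WithPiTopology.continuous_coeff ℂ k
    · simp_rw [coeff_expand_of_not_dvd d hd _ h]
      exact continuous_const

theorem expand_euler (d c : ℕ) (hd : d ≠ 0) (hc : c ≠ 0) : expand d hd (euler c) = euler (d * c) := by
  rw [euler, (multipliable_euler hc).map_tprod (expand d hd) (continuous_expand d hd), euler]
  congr 1 with i : 1
  rw [map_sub, map_pow, expand_X, map_one, ← pow_mul, mul_assoc]

/-! ### The Jacobi triple product -/

/-- The exponent `m k(k-1)/2 + s k` of the general theta series. The truncation to `ℕ` is harmless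
for `s ≤ m`, see `two_mul_thetaExp`. -/
def thetaExp (s m : ℕ) (k : ℤ) : ℕ := (m * (k * (k - 1) / 2) + s * k).toNat

/-- Ramanujan's theta series `f(q^s, q^(m-s)) = ∑_{k ∈ ℤ} q^(m k(k-1)/2 + s k)`, for `s ≤ m` and
`m ≠ 0`. In particular `theta 1 2` is `φ(q) = ∑ q^(k²)`. -/
noncomputable def theta (s m : ℕ) : ℂ⟦X⟧ := ∑' k : ℤ, X ^ thetaExp s m k

theorem two_mul_tri (k : ℤ) : 2 * (k * (k - 1) / 2) = k * (k - 1) :=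
  Int.mul_ediv_cancel' (by
    rcases Int.even_or_odd' k with ⟨c, rfl | rfl⟩
    · exact ⟨c * (2 * c - 1), by ring⟩
    · exact ⟨c * (2 * c + 1), by ring⟩)

theorem two_mul_thetaExp {s m : ℕ} (h : s ≤ m) (k : ℤ) :
    2 * (thetaExp s m k : ℤ) = m * (k * (k - 1)) + 2 * s * k := by
  have h1 := two_mul_tri k
  have h2 : (s : ℤ) ≤ m := by exact_mod_cast h
  have h3 : (0 : ℤ) ≤ s := by positivity
  have : 0 ≤ (m : ℤ) * (k * (k - 1) / 2) + s * k := by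
    rcases le_or_gt 0 k with hk | hk
    · have : 0 ≤ k * (k - 1) / 2 := by
        rcases eq_or_lt_of_le hk with rfl | hk'
        · simp
        · nlinarith
      positivity
    · nlinarith [mul_nonneg h3 (by nlinarith : (0 : ℤ) ≤ -k - 1),
        mul_nonneg (sub_nonneg.2 h2) (by nlinarith : (0 : ℤ) ≤ k * (k - 1)),
        mul_nonneg h3 (by nlinarith : (0:ℤ) ≤ k * (k + 1))]
  rw [thetaExp, Int.toNat_of_nonneg this, mul_add]
  linear_combination (m : ℤ) * h1

/-- Linear growth of the exponents; it makes all theta series summable. -/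
theorem abs_le_thetaExp {s m : ℕ} (h : s ≤ m) (hm : m ≠ 0) (k : ℤ) :
    |k| ≤ (thetaExp s m k : ℤ) + 1 := by
  have h1 := two_mul_thetaExp h k
  have h2 : (s : ℤ) ≤ m := by exact_mod_cast h
  have h3 : (0 : ℤ) ≤ s := by positivity
  have h4 : (1 : ℤ) ≤ m := by exact_mod_cast Nat.one_le_iff_ne_zero.2 hm
  rw [abs_le]
  constructor
  · by_contra! hk
    have hk1 : k < -1 := by omega
    nlinarith [mul_nonneg (sub_nonneg.2 h2) (by nlinarith : (0 : ℤ) ≤ -k),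
      mul_nonneg (sub_nonneg.2 h4) (by nlinarith : (0:ℤ) ≤ k * (k + 1))]
  · by_contra! hk
    have hk1 : 1 < k := by omega
    nlinarith [mul_nonneg h3 (by nlinarith : (0 : ℤ) ≤ k),
      mul_nonneg (sub_nonneg.2 h4) (by nlinarith : (0:ℤ) ≤ k * (k - 1))]

theorem finite_thetaExp_le {s m : ℕ} (h : s ≤ m) (hm : m ≠ 0) (d : ℕ) :
    {k | thetaExp s m k ≤ d}.Finite := by
  refine (Set.finite_Icc (-(d + 1) : ℤ) (d + 1)).subset fun k hk => ?_
  have := abs_le.1 (abs_le_thetaExp h hm k)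
  simp only [Set.mem_ofPred_eq] at hk
  constructor <;> omega

theorem summable_X_pow {α : Type*} {e : α → ℕ} (h : ∀ d, {a | e a ≤ d}.Finite) :
    Summable fun a => (X : ℂ⟦X⟧) ^ e a := by
  rw [WithPiTopology.summable_iff_summable_coeff]
  refine fun d => summable_of_hasFiniteSupport ((h d).subset fun a ha => ?_)
  by_contra hd
  simp only [Set.mem_ofPred_eq, not_le] at hd
  simp [coeff_X_pow, hd.ne] at ha

theorem summable_theta {s m : ℕ} (h : s ≤ m) (hm : m ≠ 0) :
    Summable fun k : ℤ => (X : ℂ⟦X⟧) ^ thetaExp s m k :=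
  summable_X_pow (finite_thetaExp_le h hm)

theorem tendsto_prod_euler {m : ℕ} (hm : m ≠ 0) :
    Tendsto (fun n => ∏ i ∈ Finset.range n, (1 - ((X : ℂ⟦X⟧) ^ m) ^ (i + 1))) atTop
      (𝓝 (euler m)) := by
  simp only [← pow_mul]
  exact (multipliable_euler hm).hasProd.tendsto_prod_nat

/-- The central Gaussian binomials `[2n choose n+k]` in base `q^m` tend to `1/∏ (1 - q^(m n))`. -/
theorem tendsto_gaussBinom {m : ℕ} (hm : m ≠ 0) (k : ℤ) :
    Tendsto (fun n : ℕ => gaussBinom ((X : ℂ⟦X⟧) ^ m) (n + n) (k + n).toNat * euler m) atTop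
      (𝓝 1) := by
  set u : ℕ → ℂ⟦X⟧ := fun i => 1 - (X ^ m) ^ (i + 1) with hu
  have hcc (i : ℕ) : constantCoeff (u i) ≠ 0 := by simp [hu, hm]
  have hinv (i : ℕ) : u i * (u i)⁻¹ = 1 := PowerSeries.mul_inv_cancel _ (hcc i)
  have hmult : Multipliable fun i => (u i)⁻¹ := multipliable_of_X_pow_dvd fun i => by
    have h1 : (u i)⁻¹ - 1 = -(u i - 1) * (u i)⁻¹ := by linear_combination hinv i
    have h2 : X ^ i ∣ u i - 1 := by
      simp only [hu, ← pow_mul]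
      exact X_pow_dvd_one_sub (by nlinarith [Nat.pos_of_ne_zero hm])
    rw [h1]
    exact (dvd_neg.2 h2).mul_right _
  have t1 := tendsto_prod_euler hm
  have t2 := hmult.hasProd.tendsto_prod_nat
  set I := ∏' i, (u i)⁻¹
  have hEI : euler m * I = 1 := by
    refine tendsto_nhds_unique (t1.mul t2) ?_
    simp_rw [← Finset.prod_mul_distrib]
    refine tendsto_const_nhds.congr fun n => ?_
    rw [Finset.prod_eq_one fun i _ => hinv i]
  have a1 : Tendsto (fun n : ℕ => n + n) atTop atTop :=
    tendsto_atTop_mono (fun n => Nat.le_add_left n n) tendsto_id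
  have a2 : Tendsto (fun n : ℕ => (k + n).toNat) atTop atTop :=
    tendsto_atTop.2 fun b => eventually_atTop.2 ⟨b + k.natAbs, fun n hn => by omega⟩
  have a3 : Tendsto (fun n : ℕ => (n - k).toNat) atTop atTop :=
    tendsto_atTop.2 fun b => eventually_atTop.2 ⟨b + k.natAbs, fun n hn => by omega⟩
  have t3 := (((t1.comp a1).mul (t2.comp a2)).mul (t2.comp a3)).mul_const (euler m)
  have e : euler m * I * I * euler m = 1 := by linear_combination (euler m * I + 1) * hEI
  rw [e] at t3
  refine t3.congr' (eventually_atTop.2 ⟨k.natAbs, fun n hn => ?_⟩)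
  have hg := gaussBinom_add_mul ((X : ℂ⟦X⟧) ^ m) (n - k).toNat (k + n).toNat
  have hn' : (n - k).toNat + (k + n).toNat = n + n := by omega
  rw [hn'] at hg
  have hpi (j : ℕ) : (∏ i ∈ Finset.range j, u i) * ∏ i ∈ Finset.range j, (u i)⁻¹ = 1 := by
    rw [← Finset.prod_mul_distrib, Finset.prod_eq_one fun i _ => hinv i]
  have h1 := hpi (k + n).toNat
  have h2 := hpi (n - k).toNat
  simp only [Function.comp_apply]
  rw [← hg]
  simp only [hu] at h1 h2 ⊢
  set g := gaussBinom ((X : ℂ⟦X⟧) ^ m) (n + n) (k + n).toNat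
  set p1 := ∏ i ∈ Finset.range (k + n).toNat, (1 - ((X : ℂ⟦X⟧) ^ m) ^ (i + 1))
  set p2 := ∏ i ∈ Finset.range (n - k).toNat, (1 - ((X : ℂ⟦X⟧) ^ m) ^ (i + 1))
  set q1 := ∏ i ∈ Finset.range (k + n).toNat, (1 - ((X : ℂ⟦X⟧) ^ m) ^ (i + 1))⁻¹
  set q2 := ∏ i ∈ Finset.range (n - k).toNat, (1 - ((X : ℂ⟦X⟧) ^ m) ^ (i + 1))⁻¹
  linear_combination g * euler m * (h1 * p2 * q2 + h2)

theorem X_pow_thetaExp_succ {s m : ℕ} (h : s ≤ m) (k : ℕ) :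
    (X : ℂ⟦X⟧) ^ thetaExp s m (k + 1) = X ^ thetaExp s m k * X ^ s * (X ^ m) ^ k := by
  rw [← pow_mul, ← pow_add, ← pow_add]
  congr 1
  have h1 := two_mul_thetaExp h (k + 1)
  have h2 := two_mul_thetaExp h k
  zify
  linarith

theorem X_pow_thetaExp_neg_succ {s m : ℕ} (h : s ≤ m) (k : ℕ) :
    (X : ℂ⟦X⟧) ^ thetaExp s m (-(k + 1)) = X ^ thetaExp s m (-k) * X ^ (m - s) * (X ^ m) ^ k := by
  rw [← pow_mul, ← pow_add, ← pow_add]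
  congr 1
  have h1 := two_mul_thetaExp h (-(k + 1))
  have h2 := two_mul_thetaExp h (-k)
  zify [h]
  linarith

/-- The Jacobi triple product identity for `f(q^s, q^(m-s))`. -/
theorem theta_eq_prod {s m : ℕ} (h : s ≤ m) (hm : m ≠ 0) :
    theta s m = euler m * plusProd s m * plusProd (m - s) m := by
  set J : ℕ → ℂ⟦X⟧ := fun n =>
    (∏ i ∈ Finset.range n, (1 + X ^ (s + m * i))) * ∏ i ∈ Finset.range n, (1 + X ^ (m - s + m * i))
  have hJ : Tendsto J atTop (𝓝 (plusProd s m * plusProd (m - s) m)) :=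
    (multipliable_plusProd s hm).hasProd.tendsto_prod_nat.mul
      (multipliable_plusProd (m - s) hm).hasProd.tendsto_prod_nat
  have hJsum (n : ℕ) : J n = ∑ k ∈ Finset.Icc (-n : ℤ) n,
      gaussBinom ((X : ℂ⟦X⟧) ^ m) (n + n) (k + n).toNat * X ^ thetaExp s m k := by
    have := prod_mul_prod_eq_sum_gaussBinom ((X : ℂ⟦X⟧) ^ s) (X ^ (m - s)) (X ^ m)
      (by rw [← pow_add]; congr 1; omega) (fun k => X ^ thetaExp s m k) (by simp [thetaExp])
      (X_pow_thetaExp_succ h) (X_pow_thetaExp_neg_succ h) n n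
    simp only [← pow_mul, ← pow_add] at this
    simp only [J]
    rw [this]
    refine Finset.sum_bij' (fun j _ => (j : ℤ) - n) (fun k _ => (k + n).toNat) ?_ ?_ ?_ ?_ ?_
    · intro j hj
      simp only [Finset.mem_range] at hj
      simp only [Finset.mem_Icc]
      omega
    · intro k hk
      simp only [Finset.mem_Icc] at hk
      simp only [Finset.mem_range]
      omega
    · intro j hj
      simp
    · intro k hk
      simp only [Finset.mem_Icc] at hk
      omega
    · intro j hj
      simp
  refine tendsto_nhds_unique (f := fun n => euler m * J n) (l := atTop) ?_ (by
    rw [mul_assoc]; exact hJ.const_mul _)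
  rw [WithPiTopology.tendsto_iff_coeff_tendsto]
  intro d
  -- only the finitely many `k ∈ K` contribute to the coefficient of `q^d`
  set K := (finite_thetaExp_le h hm d).toFinset with hK
  have hθ : coeff d (theta s m) = ∑ k ∈ K, coeff d (1 * (X : ℂ⟦X⟧) ^ thetaExp s m k) := by
    rw [theta, (summable_theta h hm).map_tsum (coeff (R := ℂ) d)
      (WithPiTopology.continuous_coeff ℂ d)]
    simp only [one_mul]
    refine tsum_eq_sum fun k hk => ?_
    simp only [hK, Set.Finite.mem_toFinset, Set.mem_ofPred_eq, not_le] at hk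
    simp [coeff_X_pow, hk.ne]
  rw [hθ]
  have hlim := tendsto_finsetSum K fun k _ =>
    ((WithPiTopology.continuous_coeff ℂ d).tendsto _).comp
      ((tendsto_gaussBinom hm k).mul_const ((X : ℂ⟦X⟧) ^ thetaExp s m k))
  refine hlim.congr' (eventually_atTop.2 ⟨d + 1, fun n hn => ?_⟩)
  simp only [hJsum, Finset.mul_sum, map_sum]
  have hsub : K ⊆ Finset.Icc (-n : ℤ) n := fun k hk => by
    simp only [hK, Set.Finite.mem_toFinset, Set.mem_ofPred_eq] at hk
    have := abs_le.1 (abs_le_thetaExp h hm k)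
    simp only [Finset.mem_Icc]
    omega
  rw [← Finset.sum_subset hsub]
  · refine Finset.sum_congr rfl fun k _ => ?_
    simp only [Function.comp_apply]
    congr 1
    ring
  · intro k _ hk
    simp only [hK, Set.Finite.mem_toFinset, Set.mem_ofPred_eq, not_le] at hk
    rw [← mul_assoc]
    exact X_pow_dvd_iff.1 (dvd_mul_left _ _) d hk

theorem expand_theta (d s m : ℕ) (hd : d ≠ 0) (h : s ≤ m) (hm : m ≠ 0) :
    expand d hd (theta s m) = theta (d * s) (d * m) := by
  rw [theta, (summable_theta h hm).map_tsum (expand d hd) (continuous_expand d hd), theta]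
  congr 1 with k : 1
  rw [map_pow, expand_X, ← pow_mul]
  congr 1
  have h1 := two_mul_thetaExp h k
  have h2 := two_mul_thetaExp (Nat.mul_le_mul_left d h) k
  zify
  push_cast at h2
  linarith [congrArg (fun x : ℤ => d * x) h1]

/-! ### Dissections of theta series -/

/-- Splitting a sum over `β` along a partition of `β` into five parametrized pieces. -/
theorem tsum_eq_sum_tsum_comp {α β : Type*} {F : β → ℂ⟦X⟧} (hF : Summable F) (g : Fin 5 → α → β)
    (hg : Function.Bijective fun p : Fin 5 × α => g p.1 p.2) :
    ∑' b, F b = ∑ c, ∑' a, F (g c a) := by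
  have h1 := (Equiv.ofBijective _ hg).tsum_eq F
  have h2 : Summable fun p : Fin 5 × α => F (g p.1 p.2) := hF.comp_injective hg.injective
  rw [← h1]
  exact h2.tsum_prod.trans (tsum_fintype _)

theorem theta_symm {s m : ℕ} (h : s ≤ m) : theta (m - s) m = theta s m := by
  rw [theta, theta, ← (Equiv.neg ℤ).tsum_eq]
  congr 1 with k : 1
  congr 1
  have h1 := two_mul_thetaExp h k
  have h2 := two_mul_thetaExp (Nat.sub_le m s) (-k)
  push_cast [h] at h2
  simp only [Equiv.neg_apply]
  zify
  linarith

/-- The 5-dissection of `2 ψ(q)`: the summation index is written as `5k + c` with `|c| ≤ 2`. The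
residues `0, -1` and `1, -2` give the same series. -/
theorem theta_one_one_dissection :
    theta 1 1 = 2 * theta 15 25 + 2 * X * theta 20 25 + X ^ 3 * theta 25 25 := by
  let c : Fin 5 → ℤ := ![0, -1, 1, -2, 2]
  have hb : Function.Bijective fun p : Fin 5 × ℤ => 5 * p.2 + c p.1 := by
    constructor
    · rintro ⟨a, i⟩ ⟨b, j⟩ h
      fin_cases a <;> fin_cases b <;> simp [c] at h ⊢ <;> omega
    · intro k
      have : k % 5 = 0 ∨ k % 5 = 4 ∨ k % 5 = 1 ∨ k % 5 = 3 ∨ k % 5 = 2 := by omega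
      rcases this with h | h | h | h | h
      · exact ⟨(0, k / 5), by simp [c]; omega⟩
      · exact ⟨(1, k / 5 + 1), by simp [c]; omega⟩
      · exact ⟨(2, k / 5), by simp [c]; omega⟩
      · exact ⟨(3, k / 5 + 1), by simp [c]; omega⟩
      · exact ⟨(4, k / 5), by simp [c]; omega⟩
  have key (c : ℤ) (e s : ℕ) (hs : s ≤ 25) (h : ∀ k : ℤ, (5 * k + c) * (5 * k + c + 1) =
      2 * e + 25 * (k * (k - 1)) + 2 * s * k) :
      ∑' k : ℤ, (X : ℂ⟦X⟧) ^ thetaExp 1 1 (5 * k + c) = X ^ e * theta s 25 := by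
    rw [theta, ← (summable_theta hs (by norm_num)).tsum_mul_left]
    congr 1 with k : 1
    rw [← pow_add]
    congr 1
    have h1 := two_mul_thetaExp (le_refl 1) (5 * k + c)
    have h2 := two_mul_thetaExp hs k
    have h3 := h k
    push_cast at h1 h2
    zify
    linarith
  rw [theta, tsum_eq_sum_tsum_comp (summable_theta le_rfl one_ne_zero) (fun a k => 5 * k + c a) hb]
  simp only [Fin.sum_univ_five]
  rw [key (c 0) 0 15 (by norm_num) (fun k => by simp [c]; ring),
    key (c 1) 0 10 (by norm_num) (fun k => by simp [c]; ring),
    key (c 2) 1 20 (by norm_num) (fun k => by simp [c]; ring),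
    key (c 3) 1 5 (by norm_num) (fun k => by simp [c]; ring),
    key (c 4) 3 25 (by norm_num) (fun k => by simp [c]; ring)]
  rw [← theta_symm (by norm_num : 15 ≤ 25), ← theta_symm (by norm_num : 20 ≤ 25)]
  ring

theorem summable_theta_mul {s m s' m' : ℕ} (h : s ≤ m) (hm : m ≠ 0) (h' : s' ≤ m')
    (hm' : m' ≠ 0) :
    Summable fun p : ℤ × ℤ => (X : ℂ⟦X⟧) ^ (thetaExp s m p.1 + thetaExp s' m' p.2) :=
  summable_X_pow fun d =>
    ((finite_thetaExp_le h hm d).prod (finite_thetaExp_le h' hm' d)).subset fun p hp => by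
      simp only [Set.mem_ofPred_eq] at hp
      exact ⟨by simp only [Set.mem_ofPred_eq]; omega, by simp only [Set.mem_ofPred_eq]; omega⟩

theorem theta_mul_theta {s m s' m' : ℕ} (h : s ≤ m) (hm : m ≠ 0) (h' : s' ≤ m') (hm' : m' ≠ 0) :
    theta s m * theta s' m' =
      ∑' p : ℤ × ℤ, (X : ℂ⟦X⟧) ^ (thetaExp s m p.1 + thetaExp s' m' p.2) := by
  have hs := summable_theta_mul h hm h' hm'
  simp only [pow_add] at hs ⊢
  exact (summable_theta h hm).tsum_mul_tsum (summable_theta h' hm') hs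

/-- A double sum whose exponent separates is a product of two theta series. -/
theorem pow_mul_theta_mul_theta (e : ℕ) {s m s' m' : ℕ} (h : s ≤ m) (hm : m ≠ 0) (h' : s' ≤ m')
    (hm' : m' ≠ 0) {f : ℤ × ℤ → ℕ} (hf : ∀ p : ℤ × ℤ, 2 * (f p : ℤ) = 2 * e +
      (m * (p.1 * (p.1 - 1)) + 2 * s * p.1) + (m' * (p.2 * (p.2 - 1)) + 2 * s' * p.2)) :
    ∑' p : ℤ × ℤ, (X : ℂ⟦X⟧) ^ f p = X ^ e * (theta s m * theta s' m') := by
  rw [theta_mul_theta h hm h' hm', ← (summable_theta_mul h hm h' hm').tsum_mul_left]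
  congr 1 with p : 1
  rw [← pow_add]
  congr 1
  have h1 := two_mul_thetaExp h p.1
  have h2 := two_mul_thetaExp h' p.2
  have h3 := hf p
  zify
  linarith

/-- `ψ(q)² = q ψ(q⁵)² + f(q,q⁴) f(q²,q³)`, up to a factor 4. -/
theorem theta_one_one_sq :
    theta 1 1 ^ 2 = X * theta 5 5 ^ 2 + 4 * (theta 3 5 * theta 4 5) := by
  -- In terms of the odd numbers `u = 2x + 1`, `v = 2y + 1`, the pairs with `5 ∣ 2u + v` are
  -- parametrized by `g 0`, those with `2u + v ≡ 1` mod 5 by `g 1`; the remaining three classes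
  -- arise from the latter by the rotation `(u, v) ↦ (-v, u)`, which preserves `u² + v²`.
  let g : Fin 5 → ℤ × ℤ → ℤ × ℤ := ![fun p => (2 * p.1 + p.2 + 1, p.1 - 2 * p.2 - 1),
    fun p => (2 * p.1 + p.2, p.1 - 2 * p.2 - 1), fun p => (-(p.1 - 2 * p.2), 2 * p.1 + p.2),
    fun p => (-(2 * p.1 + p.2) - 1, -(p.1 - 2 * p.2)),
    fun p => (p.1 - 2 * p.2 - 1, -(2 * p.1 + p.2) - 1)]
  have hb : Function.Bijective fun p : Fin 5 × (ℤ × ℤ) => g p.1 p.2 := by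
    constructor
    · rintro ⟨a, i, i'⟩ ⟨b, j, j'⟩ h
      fin_cases a <;> fin_cases b <;> simp [g] at h ⊢ <;> omega
    · rintro ⟨x, y⟩
      have : (2 * x + y) % 5 = 1 ∨ (2 * x + y) % 5 = 4 ∨ (2 * x + y) % 5 = 0 ∨
        (2 * x + y) % 5 = 3 ∨ (2 * x + y) % 5 = 2 := by omega
      rcases this with h | h | h | h | h
      · exact ⟨(0, (2 * x + y - 1) / 5, (x - 2 * y - 3) / 5), by simp [g]; omega⟩
      · exact ⟨(1, (2 * x + y + 1) / 5, (x - 2 * y - 2) / 5), by simp [g]; omega⟩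
      · exact ⟨(2, (2 * y - x) / 5, (2 * x + y) / 5), by simp [g]; omega⟩
      · exact ⟨(3, -(2 * x + y + 2) / 5, (2 * y - x - 1) / 5), by simp [g]; omega⟩
      · exact ⟨(4, (x - 2 * y - 1) / 5, -(2 * x + y + 3) / 5), by simp [g]; omega⟩
  have hE (x y : ℤ) : 2 * ((thetaExp 1 1 x + thetaExp 1 1 y : ℕ) : ℤ) =
      x * (x + 1) + y * (y + 1) := by
    have h1 := two_mul_thetaExp (le_refl 1) x
    have h2 := two_mul_thetaExp (le_refl 1) y
    push_cast at h1 h2 ⊢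
    linarith
  rw [sq, theta_mul_theta le_rfl one_ne_zero le_rfl one_ne_zero, tsum_eq_sum_tsum_comp
    (summable_theta_mul le_rfl one_ne_zero le_rfl one_ne_zero) g hb, Fin.sum_univ_five]
  rw [pow_mul_theta_mul_theta 1 (le_refl 5) (by norm_num) (le_refl 5) (by norm_num)]
  rotate_left
  · rintro ⟨i, j⟩; rw [hE]; simp [g]; ring
  have h (c : Fin 5) (hc : c ≠ 0) : ∑' p : ℤ × ℤ, (X : ℂ⟦X⟧) ^
      (thetaExp 1 1 (g c p).1 + thetaExp 1 1 (g c p).2) = theta 3 5 * theta 4 5 := by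
    rw [pow_mul_theta_mul_theta 0 (by norm_num : 3 ≤ 5) (by norm_num) (by norm_num : 4 ≤ 5)
      (by norm_num), pow_zero, one_mul]
    rintro ⟨i, j⟩
    rw [hE]
    fin_cases c
    · exact absurd rfl hc
    all_goals simp [g]; ring
  rw [h 1 (by decide), h 2 (by decide), h 3 (by decide), h 4 (by decide)]
  ring

/-- `φ(q)² - φ(q⁵)² = 4 q f(q,q⁹) f(q³,q⁷)`. -/
theorem theta_one_two_sq :
    theta 1 2 ^ 2 = theta 5 10 ^ 2 + 4 * X * (theta 7 10 * theta 1 10) := by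
  -- `g 0` parametrizes the pairs with `5 ∣ 2x + y` and `g 1` those with `2x + y ≡ 1` mod 5; the
  -- remaining three classes arise from the latter by the rotation `(x, y) ↦ (-y, x)`.
  let g : Fin 5 → ℤ × ℤ → ℤ × ℤ := ![fun p => (2 * p.1 + p.2, p.1 - 2 * p.2),
    fun p => (2 * p.1 + p.2, p.1 - 2 * p.2 + 1), fun p => (-(p.1 - 2 * p.2 + 1), 2 * p.1 + p.2),
    fun p => (-(2 * p.1 + p.2), -(p.1 - 2 * p.2 + 1)),
    fun p => (p.1 - 2 * p.2 + 1, -(2 * p.1 + p.2))]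
  have hb : Function.Bijective fun p : Fin 5 × (ℤ × ℤ) => g p.1 p.2 := by
    constructor
    · rintro ⟨a, i, i'⟩ ⟨b, j, j'⟩ h
      fin_cases a <;> fin_cases b <;> simp [g] at h ⊢ <;> omega
    · rintro ⟨x, y⟩
      have : (2 * x + y) % 5 = 0 ∨ (2 * x + y) % 5 = 1 ∨ (2 * x + y) % 5 = 3 ∨
        (2 * x + y) % 5 = 4 ∨ (2 * x + y) % 5 = 2 := by omega
      rcases this with h | h | h | h | h
      · exact ⟨(0, (2 * x + y) / 5, (x - 2 * y) / 5), by simp [g]; omega⟩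
      · exact ⟨(1, (2 * x + y - 1) / 5, (x - 2 * y + 2) / 5), by simp [g]; omega⟩
      · exact ⟨(2, (2 * y - x - 1) / 5, (2 * x + y + 2) / 5), by simp [g]; omega⟩
      · exact ⟨(3, -(2 * x + y + 1) / 5, (2 * y - x + 2) / 5), by simp [g]; omega⟩
      · exact ⟨(4, (x - 2 * y - 1) / 5, -(2 * x + y - 2) / 5), by simp [g]; omega⟩
  have hE (x y : ℤ) : 2 * ((thetaExp 1 2 x + thetaExp 1 2 y : ℕ) : ℤ) =
      2 * x ^ 2 + 2 * y ^ 2 := by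
    have h1 := two_mul_thetaExp (by norm_num : 1 ≤ 2) x
    have h2 := two_mul_thetaExp (by norm_num : 1 ≤ 2) y
    push_cast at h1 h2 ⊢
    linarith
  rw [sq, theta_mul_theta (by norm_num) (by norm_num) (by norm_num) (by norm_num),
    tsum_eq_sum_tsum_comp (summable_theta_mul (by norm_num) (by norm_num) (by norm_num)
      (by norm_num)) g hb, Fin.sum_univ_five]
  rw [pow_mul_theta_mul_theta 0 (by norm_num : 5 ≤ 10) (by norm_num) (by norm_num : 5 ≤ 10)
    (by norm_num)]
  rotate_left
  · rintro ⟨i, j⟩; rw [hE]; simp [g]; ring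
  have h (c : Fin 5) (hc : c ≠ 0) : ∑' p : ℤ × ℤ, (X : ℂ⟦X⟧) ^
      (thetaExp 1 2 (g c p).1 + thetaExp 1 2 (g c p).2) = X ^ 1 * (theta 7 10 * theta 1 10) := by
    rw [pow_mul_theta_mul_theta 1 (by norm_num : 7 ≤ 10) (by norm_num) (by norm_num : 1 ≤ 10)
      (by norm_num)]
    rintro ⟨i, j⟩
    rw [hE]
    fin_cases c
    · exact absurd rfl hc
    all_goals simp [g]; ring
  rw [h 1 (by decide), h 2 (by decide), h 3 (by decide), h 4 (by decide)]
  ring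

/-! ### The series `ψ` over the complex numbers -/

/-- `ψ(q)` with complex coefficients. -/
noncomputable def psi : ℂ⟦X⟧ := map (Int.castRingHom ℂ) thetaPsi

theorem hasSum_psi : HasSum (fun j : ℕ => (X : ℂ⟦X⟧) ^ (j * (j + 1) / 2)) psi := by
  rw [WithPiTopology.hasSum_iff_hasSum_coeff]
  intro d
  have : coeff d psi = ∑ j ∈ Finset.range (d + 1), coeff d ((X : ℂ⟦X⟧) ^ (j * (j + 1) / 2)) := by
    simp [psi, thetaPsi, coeff_X_pow, eq_comm]
  rw [this]
  refine hasSum_sum_of_ne_finset_zero fun j hj => ?_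
  rw [Finset.mem_range, not_lt] at hj
  have : j ≤ j * (j + 1) / 2 := by
    rw [Nat.le_div_iff_mul_le two_pos]
    nlinarith
  rw [coeff_X_pow, if_neg (by omega)]

/-- Over `k ∈ ℤ` each triangular number `k(k+1)/2` occurs twice. -/
theorem theta_one_one : theta 1 1 = 2 * psi := by
  have hE (j : ℕ) : j * (j + 1) / 2 = thetaExp 1 1 j ∧
      j * (j + 1) / 2 = thetaExp 1 1 (-((j : ℤ) + 1)) := by
    have h1 := two_mul_thetaExp (le_refl 1) (j : ℤ)
    have h2 := two_mul_thetaExp (le_refl 1) (-((j : ℤ) + 1))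
    have h3 : 2 * (j * (j + 1) / 2) = j * (j + 1) :=
      Nat.mul_div_cancel' (Nat.even_mul_succ_self j).two_dvd
    zify at h3
    push_cast at h1 h2
    constructor
    · zify; linarith
    · zify; linarith
  have h := HasSum.of_nat_of_neg_add_one (f := fun k : ℤ => (X : ℂ⟦X⟧) ^ thetaExp 1 1 k)
    (by simpa only [(hE _).1] using hasSum_psi) (by simpa only [(hE _).2] using hasSum_psi)
  rw [theta, h.tsum_eq]
  ring

theorem constantCoeff_psi : constantCoeff psi = 1 := by
  rw [← coeff_zero_eq_constantCoeff_apply, psi, coeff_map, thetaPsi, coeff_mk]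
  simp
  rfl

theorem theta_mul_self (d : ℕ) (hd : d ≠ 0) : theta d d = 2 * expand d hd psi := by
  have := expand_theta d 1 1 hd le_rfl one_ne_zero
  rw [mul_one, theta_one_one] at this
  rw [← this, map_mul, map_ofNat]

/-! ### Product formulas -/

theorem hasProd_euler {d : ℕ} (hd : d ≠ 0) :
    HasProd (fun i : ℕ => (1 - X ^ (d * (i + 1)) : ℂ⟦X⟧)) (euler d) :=
  (multipliable_euler hd).hasProd

theorem hasProd_plusProd (s : ℕ) {m : ℕ} (hm : m ≠ 0) :
    HasProd (fun i : ℕ => (1 + X ^ (s + m * i) : ℂ⟦X⟧)) (plusProd s m) :=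
  (multipliable_plusProd s hm).hasProd

theorem natCast_ne_zero {n : ℕ} (hn : n ≠ 0) : (n : ℂ⟦X⟧) ≠ 0 := fun h => by
  have := congrArg (constantCoeff (R := ℂ)) h
  simp [hn] at this

/-- Euler's identity `∏ (1 + q^(dn)) = E_{2d} / E_d`. -/
theorem plusProd_mul_euler {d : ℕ} (hd : d ≠ 0) : plusProd d d * euler d = euler (2 * d) := by
  refine HasProd.unique ((hasProd_plusProd d hd).mul (hasProd_euler hd)) ?_
  convert (hasProd_euler (by omega : 2 * d ≠ 0)) using 2 with i
  rw [show d + d * i = d * (i + 1) by ring, show 2 * d * (i + 1) = d * (i + 1) + d * (i + 1) by ring,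
    pow_add]
  ring

/-- Splitting the index of a product modulo `d`. -/
theorem plusProd_eq_prod (s d : ℕ) {m : ℕ} (hm : m ≠ 0) (hd : d ≠ 0) :
    plusProd s m = ∏ c ∈ Finset.range d, plusProd (s + m * c) (d * m) := by
  have h (c : ℕ) (hc : c ∈ Finset.range d) : HasProd
      (fun n => if n % d = c then (1 + X ^ (s + m * n) : ℂ⟦X⟧) else 1)
      (plusProd (s + m * c) (d * m)) := by
    have h1 : plusProd (s + m * c) (d * m) =
        ∏' n, if n % d = c then (1 + X ^ (s + m * n) : ℂ⟦X⟧) else 1 := by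
      rw [← tprod_arith d c (Finset.mem_range.1 hc) (fun n => (1 + X ^ (s + m * n) : ℂ⟦X⟧)), plusProd]
      congr 1 with i : 1
      congr 2
      ring
    rw [h1]
    exact (multipliable_of_X_pow_dvd fun i => X_pow_dvd_ite
      (X_pow_dvd_one_add (by nlinarith [Nat.pos_of_ne_zero hm]))).hasProd
  refine HasProd.unique ?_ (hasProd_prod h)
  convert (hasProd_plusProd s hm) using 2 with i
  rw [Finset.prod_ite_eq, if_pos (Finset.mem_range.2 (Nat.mod_lt _ (Nat.pos_of_ne_zero hd)))]

theorem plusProd_zero_one : plusProd 0 1 = 2 * plusProd 1 1 := by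
  have h : HasProd (fun i : ℕ => (1 + X ^ (0 + 1 * (i + 1)) : ℂ⟦X⟧)) (plusProd 1 1) := by
    convert hasProd_plusProd 1 one_ne_zero using 4
    ring
  have h' := HasProd.zero_mul (f := fun i : ℕ => (1 + X ^ (0 + 1 * i) : ℂ⟦X⟧)) h
  rw [(hasProd_plusProd 0 one_ne_zero).unique h']
  norm_num

/-- Gauss's product formula `ψ(q) = E₂² / E₁`. -/
theorem psi_mul_euler : psi * euler 1 = euler 2 ^ 2 := by
  have h1 := theta_eq_prod (le_refl 1) one_ne_zero
  have h2 := plusProd_mul_euler one_ne_zero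
  rw [theta_one_one, Nat.sub_self, plusProd_zero_one] at h1
  refine mul_left_cancel₀ (natCast_ne_zero two_ne_zero) ?_
  rw [Nat.cast_two]
  rw [mul_one] at h2
  rw [← h2]
  linear_combination euler 1 * h1

theorem psi_five_mul_euler : expand 5 (by norm_num) psi * euler 5 = euler 10 ^ 2 := by
  simpa [expand_euler] using congrArg (expand 5 (by norm_num)) psi_mul_euler

/-- `ψ(q)² - q ψ(q⁵)² = f(q,q⁴) f(q²,q³)`. -/
theorem psi_sq :
    psi ^ 2 = X * expand 5 (by norm_num) psi ^ 2 + theta 3 5 * theta 4 5 := by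
  have h := theta_one_one_sq
  rw [theta_mul_self 5 (by norm_num), theta_one_one] at h
  refine mul_left_cancel₀ (natCast_ne_zero four_ne_zero) ?_
  push_cast
  linear_combination h

theorem psi_ne_zero : psi ≠ 0 := fun h => by simpa [h] using constantCoeff_psi

theorem expand_ne_zero {d : ℕ} (hd : d ≠ 0) {f : ℂ⟦X⟧} (h : constantCoeff f = 1) :
    expand d hd f ≠ 0 := fun h0 => by
  have := constantCoeff_expand d hd f
  rw [h0, h] at this
  simp at this

/-- `f(q,q⁴) f(q²,q³) = E₅³ E₂ / (E₁₀ E₁)`. -/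
theorem theta_three_five_mul_theta_four_five :
    theta 3 5 * theta 4 5 * (euler 10 * euler 1) = euler 5 ^ 3 * euler 2 := by
  have h3 := theta_eq_prod (by norm_num : 3 ≤ 5) (by norm_num)
  have h4 := theta_eq_prod (by norm_num : 4 ≤ 5) (by norm_num)
  have h1 := plusProd_mul_euler one_ne_zero
  have h5 := plusProd_mul_euler (by norm_num : 5 ≠ 0)
  have hp := plusProd_eq_prod 1 5 one_ne_zero (by norm_num)
  simp only [Finset.prod_range_succ, Finset.prod_range_zero] at hp
  norm_num at hp h1 h3 h4 h5
  rw [← h5, ← h1, h3, h4, hp]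
  ring

theorem plusProd_one_two_mul : plusProd 1 2 * (euler 4 * euler 1) = euler 2 ^ 2 := by
  have h1 := plusProd_mul_euler one_ne_zero
  have h2 := plusProd_mul_euler (by norm_num : 2 ≠ 0)
  have hp := plusProd_eq_prod 1 2 one_ne_zero (by norm_num)
  simp only [Finset.prod_range_succ, Finset.prod_range_zero] at hp
  norm_num at hp h1 h2
  rw [hp] at h1
  rw [← h2]
  linear_combination euler 2 * h1

theorem expand_plusProd (d s m : ℕ) (hd : d ≠ 0) (hm : m ≠ 0) :
    expand d hd (plusProd s m) = plusProd (d * s) (d * m) := by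
  rw [plusProd, (multipliable_plusProd s hm).map_tprod (expand d hd) (continuous_expand d hd),
    plusProd]
  congr 1 with i : 1
  rw [map_add, map_pow, expand_X, map_one, ← pow_mul, mul_add, mul_assoc]

/-- `φ(q) = E₂⁵ / (E₄² E₁²)`. -/
theorem theta_one_two_mul : theta 1 2 * (euler 4 ^ 2 * euler 1 ^ 2) = euler 2 ^ 5 := by
  have h := theta_eq_prod (by norm_num : 1 ≤ 2) (by norm_num)
  have h1 := plusProd_one_two_mul
  norm_num at h
  rw [h]
  linear_combination euler 2 * (plusProd 1 2 * (euler 4 * euler 1) + euler 2 ^ 2) * h1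

/-- `f(q,q⁹) f(q³,q⁷) = E₂² E₂₀ E₅ / (E₄ E₁)`. -/
theorem theta_seven_ten_mul_theta_one_ten :
    theta 7 10 * theta 1 10 * (euler 4 * euler 1) = euler 2 ^ 2 * euler 20 * euler 5 := by
  have h7 := theta_eq_prod (by norm_num : 7 ≤ 10) (by norm_num)
  have h1 := theta_eq_prod (by norm_num : 1 ≤ 10) (by norm_num)
  have ho := plusProd_one_two_mul
  have ho5 := congrArg (expand 5 (by norm_num)) ho
  simp only [map_mul, map_pow, expand_euler 5 _ (by norm_num : 5 ≠ 0) (by norm_num : 4 ≠ 0),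
    expand_euler 5 _ (by norm_num : 5 ≠ 0) (by norm_num : 1 ≠ 0),
    expand_euler 5 _ (by norm_num : 5 ≠ 0) (by norm_num : 2 ≠ 0),
    expand_plusProd 5 1 2 (by norm_num) (by norm_num)] at ho5
  have hp := plusProd_eq_prod 1 5 two_ne_zero (by norm_num)
  simp only [Finset.prod_range_succ, Finset.prod_range_zero] at hp
  norm_num at hp h7 h1 ho5
  refine mul_left_cancel₀ (pow_ne_zero 2 (euler_ne_zero (by norm_num : 10 ≠ 0))) ?_
  rw [← ho]
  rw [hp] at ho ⊢
  rw [h7, h1]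
  linear_combination (-(euler 10 ^ 2 * plusProd 7 10 * plusProd 3 10 * plusProd 1 10 * plusProd 9 10 *
    (euler 4 * euler 1))) * ho5

/-- The relation `ψ(q)² - q ψ(q⁵)² = f(q,q⁴) f(q²,q³)` between infinite products. -/
theorem euler_relation_psi :
    euler 2 ^ 4 * euler 5 ^ 2 * euler 10 =
      X * euler 10 ^ 5 * euler 1 ^ 2 + euler 5 ^ 5 * euler 2 * euler 1 := by
  have h := psi_sq
  have h1 := psi_mul_euler
  have h5 := psi_five_mul_euler
  have h6 := theta_three_five_mul_theta_four_five
  set p := expand 5 (by norm_num) psi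
  calc euler 2 ^ 4 * euler 5 ^ 2 * euler 10
      = psi ^ 2 * (euler 1 ^ 2 * euler 5 ^ 2 * euler 10) := by
        rw [show euler 2 ^ 4 = (euler 2 ^ 2) ^ 2 by ring, ← h1]; ring
    _ = X * (p * euler 5) ^ 2 * euler 1 ^ 2 * euler 10 +
        theta 3 5 * theta 4 5 * (euler 10 * euler 1) * euler 1 * euler 5 ^ 2 := by rw [h]; ring
    _ = _ := by rw [h5, h6]; ring

/-- The relation `φ(q)² - φ(q⁵)² = 4 q f(q,q⁹) f(q³,q⁷)` between infinite products. -/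
theorem euler_relation_phi :
    euler 2 ^ 10 * euler 20 ^ 4 * euler 5 ^ 4 = euler 10 ^ 10 * euler 4 ^ 4 * euler 1 ^ 4 +
      4 * X * euler 2 ^ 2 * euler 20 ^ 5 * euler 5 ^ 5 * euler 4 ^ 3 * euler 1 ^ 3 := by
  have h := theta_one_two_sq
  have h1 := theta_one_two_mul
  have h5 := congrArg (expand 5 (by norm_num)) h1
  simp only [map_mul, map_pow, expand_euler 5 _ (by norm_num : 5 ≠ 0) (by norm_num : 4 ≠ 0),
    expand_euler 5 _ (by norm_num : 5 ≠ 0) (by norm_num : 1 ≠ 0),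
    expand_euler 5 _ (by norm_num : 5 ≠ 0) (by norm_num : 2 ≠ 0),
    expand_theta 5 1 2 (by norm_num) (by norm_num) (by norm_num)] at h5
  norm_num at h5
  have h6 := theta_seven_ten_mul_theta_one_ten
  calc euler 2 ^ 10 * euler 20 ^ 4 * euler 5 ^ 4
      = theta 1 2 ^ 2 * (euler 4 ^ 4 * euler 1 ^ 4 * euler 20 ^ 4 * euler 5 ^ 4) := by
        rw [show euler 2 ^ 10 = (euler 2 ^ 5) ^ 2 by ring, ← h1]; ring
    _ = (theta 5 10 * (euler 20 ^ 2 * euler 5 ^ 2)) ^ 2 * euler 4 ^ 4 * euler 1 ^ 4 +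
        4 * X * (theta 7 10 * theta 1 10 * (euler 4 * euler 1)) *
          (euler 4 ^ 3 * euler 1 ^ 3 * euler 20 ^ 4 * euler 5 ^ 4) := by rw [h]; ring
    _ = _ := by rw [h5, h6]; ring

theorem rescale_expand (a : ℂ) (d : ℕ) (hd : d ≠ 0) (f : ℂ⟦X⟧) :
    rescale a (expand d hd f) = expand d hd (rescale (a ^ d) f) := by
  ext n
  rw [coeff_rescale]
  by_cases h : d ∣ n
  · obtain ⟨k, rfl⟩ := h
    rw [coeff_expand_mul, coeff_expand_mul, coeff_rescale, pow_mul]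
  · rw [coeff_expand_of_not_dvd d hd _ h, coeff_expand_of_not_dvd d hd _ h, mul_zero]

theorem hasProd_rescale_euler (a : ℂ) :
    HasProd (fun n : ℕ => 1 - C (a ^ (n + 1)) * (X : ℂ⟦X⟧) ^ (n + 1)) (rescale a (euler 1)) := by
  convert (hasProd_euler one_ne_zero).map (rescale a) (continuous_rescale a) using 2 with n
  simp [rescale_X, mul_pow]

theorem hasProd_euler_ite (d c : ℕ) (hd : d ≠ 0) (hc : c ≠ 0) :
    HasProd (fun n : ℕ => if d ∣ n + 1 then (1 - X ^ (c * (n + 1)) : ℂ⟦X⟧) else 1)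
      (euler (c * d)) := by
  rw [euler_mul_eq_tprod_ite d c hd]
  exact (multipliable_of_X_pow_dvd fun i => X_pow_dvd_ite
    (X_pow_dvd_one_sub (by nlinarith [Nat.pos_of_ne_zero hc]))).hasProd

/-- `E₁(q) E₁(-q) = E₂³ / E₄`. -/
theorem euler_one_mul_rescale_neg_one :
    euler 1 * rescale (-1) (euler 1) * euler 4 = euler 2 ^ 3 := by
  have h2 := hasProd_euler_ite 2 1 (by norm_num) (by norm_num)
  have h := ((hasProd_euler one_ne_zero).mul (hasProd_rescale_euler (-1))).mul
    (hasProd_euler_ite 2 2 (by norm_num) (by norm_num))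
  have h' := (hasProd_euler two_ne_zero).mul (h2.mul h2)
  rw [show euler 2 ^ 3 = euler 2 * (euler (1 * 2) * euler (1 * 2)) by rw [one_mul]; ring]
  refine h.unique ?_
  convert h' using 2 with n
  rw [one_mul, two_mul, pow_add]
  by_cases hn : 2 ∣ n + 1
  · have : (-1 : ℂ) ^ (n + 1) = 1 := Even.neg_one_pow (even_iff_two_dvd.2 hn)
    rw [if_pos hn, if_pos hn, this, map_one]
    ring
  · have : (-1 : ℂ) ^ (n + 1) = -1 := Odd.neg_one_pow (by
      rwa [← Nat.not_even_iff_odd, even_iff_two_dvd])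
    rw [if_neg hn, if_neg hn, this, map_neg, map_one]
    ring

/-! ### The norm for a fifth root of unity -/

/-- The product `f(q) f(ωq) f(ω²q) f(ω³q) f(ω⁴q)`. -/
noncomputable def normFive (ω : ℂ) (f : ℂ⟦X⟧) : ℂ⟦X⟧ :=
  f * rescale ω f * rescale (ω ^ 2) f * rescale (ω ^ 3) f * rescale (ω ^ 4) f

theorem normFive_mul (ω : ℂ) (f g : ℂ⟦X⟧) : normFive ω (f * g) = normFive ω f * normFive ω g := by
  simp only [normFive, map_mul]
  ring

theorem sum_pow_eq_zero {ω : ℂ} (h : IsPrimitiveRoot ω 5) : 1 + ω + ω ^ 2 + ω ^ 3 + ω ^ 4 = 0 := by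
  have := h.geom_sum_eq_zero (by norm_num)
  simpa [Finset.sum_range_succ] using this

/-- The factor `1 - qⁿ` has norm `1 - q^(5n)` for `5 ∤ n` and `(1 - qⁿ)⁵` for `5 ∣ n`. -/
theorem normFive_euler {ω : ℂ} (h : IsPrimitiveRoot ω 5) :
    normFive ω (euler 1) * euler 25 = euler 5 ^ 6 := by
  have h0 := (multipliable_euler one_ne_zero).hasProd
  have h5 := hasProd_euler_ite 5 1 (by norm_num) (by norm_num)
  have hl := ((((h0.mul (hasProd_rescale_euler ω)).mul (hasProd_rescale_euler (ω ^ 2))).mul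
    (hasProd_rescale_euler (ω ^ 3))).mul (hasProd_rescale_euler (ω ^ 4))).mul
    (hasProd_euler_ite 5 5 (by norm_num) (by norm_num))
  have hr := (hasProd_euler (by norm_num : 5 ≠ 0)).mul
    (h5.mul (h5.mul (h5.mul (h5.mul h5))))
  rw [show euler 5 ^ 6 = euler 5 * (euler (1 * 5) * (euler (1 * 5) * (euler (1 * 5) *
    (euler (1 * 5) * euler (1 * 5))))) by rw [one_mul]; ring]
  refine hl.unique ?_
  convert hr using 2 with n
  set y : ℂ⟦X⟧ := X ^ (n + 1) with hy
  set z : ℂ⟦X⟧ := C (ω ^ (n + 1)) with hz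
  have hpow (j : ℕ) : (C ((ω ^ j) ^ (n + 1)) : ℂ⟦X⟧) = z ^ j := by
    rw [hz, ← map_pow, ← pow_mul, ← pow_mul, mul_comm]
  rw [one_mul, mul_comm 5 (n + 1), pow_mul, hpow, hpow, hpow, ← hy]
  by_cases hn : 5 ∣ n + 1
  · have : z = 1 := by rw [hz, (h.pow_eq_one_iff_dvd _).2 hn, map_one]
    rw [if_pos hn, if_pos hn, this]
    ring
  · have h1 : IsPrimitiveRoot (ω ^ (n + 1)) 5 :=
      h.pow_of_coprime _ ((Nat.Prime.coprime_iff_not_dvd (by norm_num)).2 hn).symm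
    have hs : 1 + z + z ^ 2 + z ^ 3 + z ^ 4 = 0 := by
      simpa [hz] using congrArg (C : ℂ → ℂ⟦X⟧) (sum_pow_eq_zero h1)
    rw [if_neg hn, if_neg hn]
    linear_combination (-z ^ 6 * y ^ 5 + z ^ 6 * y ^ 4 + z ^ 5 * y ^ 5 - z ^ 5 * y ^ 3 -
      z ^ 3 * y ^ 3 + z ^ 3 * y ^ 2 - z * y ^ 5 + z * y ^ 2 + y ^ 5 - y) * hs

/-- The norm of `ψ(q)` is `ψ(q⁵)⁶ / ψ(q²⁵)`. -/
theorem normFive_psi {ω : ℂ} (h : IsPrimitiveRoot ω 5) :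
    normFive ω psi * expand 25 (by norm_num) psi = expand 5 (by norm_num) psi ^ 6 := by
  have h2 : IsPrimitiveRoot (ω ^ 2) 5 := h.pow_of_coprime 2 (by norm_num)
  have n1 := normFive_euler h
  have n2 : normFive ω (euler 2) * euler 50 = euler 10 ^ 6 := by
    have e := congrArg (expand 2 (by norm_num)) (normFive_euler h2)
    have e2 : euler 2 = expand 2 (by norm_num) (euler 1) := by simp [expand_euler]
    rw [e2, normFive]
    simp only [normFive, map_mul, map_pow, expand_euler 2 25 (by norm_num) (by norm_num),
      expand_euler 2 5 (by norm_num) (by norm_num), ← pow_mul] at e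
    simp only [rescale_expand, ← pow_mul]
    rw [← e]
  have n3 := congrArg (normFive ω) psi_mul_euler
  rw [normFive_mul, sq, normFive_mul] at n3
  have p5 := psi_five_mul_euler
  have p25 : expand 25 (by norm_num) psi * euler 25 = euler 50 ^ 2 := by
    simpa [expand_euler] using congrArg (expand 25 (by norm_num)) psi_mul_euler
  have ne : euler 5 ^ 6 * euler 25 ≠ 0 :=
    mul_ne_zero (pow_ne_zero _ (euler_ne_zero (by norm_num))) (euler_ne_zero (by norm_num))
  refine mul_right_cancel₀ ne ?_
  set a := expand 5 (by norm_num) psi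
  set b := expand 25 (by norm_num) psi
  calc normFive ω psi * b * (euler 5 ^ 6 * euler 25)
      = normFive ω psi * normFive ω (euler 1) * (b * euler 25) * euler 25 := by rw [← n1]; ring
    _ = (normFive ω (euler 2) * euler 50) ^ 2 * euler 25 := by rw [n3, p25]; ring
    _ = (a * euler 5) ^ 6 * euler 25 := by rw [n2, p5]; ring
    _ = a ^ 6 * (euler 5 ^ 6 * euler 25) := by ring

/-! ### The operator `U₅` -/

/-- The operator `U_d`, sending `∑ aₙ qⁿ` to `∑ a_{dn} qⁿ`. -/
noncomputable def multisection (d : ℕ) : ℂ⟦X⟧ →ₗ[ℂ] ℂ⟦X⟧ where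
  toFun f := mk fun n => coeff (d * n) f
  map_add' f g := by ext; simp
  map_smul' a f := by ext; simp

theorem coeff_multisection (d n : ℕ) (f : ℂ⟦X⟧) :
    coeff n (multisection d f) = coeff (d * n) f := by
  simp [multisection]

theorem multisection_mul_expand (d : ℕ) (hd : d ≠ 0) (f g : ℂ⟦X⟧) :
    multisection d (f * expand d hd g) = multisection d f * g := by
  ext n
  rw [coeff_multisection, coeff_mul, coeff_mul]
  let ι : ℕ × ℕ ↪ ℕ × ℕ := ⟨fun p => (d * p.1, d * p.2), fun p q h => by
    simpa [Prod.ext_iff, hd] using h⟩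
  have hι (p : ℕ × ℕ) : ι p = (d * p.1, d * p.2) := rfl
  have h : (Finset.HasAntidiagonal.antidiagonal n).map ι ⊆
      Finset.HasAntidiagonal.antidiagonal (d * n) := by
    intro p hp
    simp only [Finset.mem_map, Finset.HasAntidiagonal.mem_antidiagonal] at hp ⊢
    obtain ⟨a, rfl, rfl⟩ := hp
    simp only [hι]
    ring
  rw [← Finset.sum_subset h]
  · rw [Finset.sum_map]
    simp [coeff_multisection, hι]
  · rintro ⟨i, j⟩ hij hn
    rw [Finset.HasAntidiagonal.mem_antidiagonal] at hij
    by_cases hj : d ∣ j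
    · have hi : d ∣ i := (Nat.dvd_add_left hj).1 ⟨n, hij⟩
      obtain ⟨a, rfl⟩ := hi
      obtain ⟨b, rfl⟩ := hj
      refine absurd ?_ hn
      simp only [Finset.mem_map, Finset.HasAntidiagonal.mem_antidiagonal]
      exact ⟨(a, b), Nat.eq_of_mul_eq_mul_left (Nat.pos_of_ne_zero hd) (by rw [← hij, mul_add]), rfl⟩
    · rw [coeff_expand_of_not_dvd d hd _ hj, mul_zero]

theorem multisection_X_pow_mul_expand {d r : ℕ} (hd : d ≠ 0) (hr : ¬ d ∣ r) (g : ℂ⟦X⟧) :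
    multisection d (X ^ r * expand d hd g) = 0 := by
  rw [multisection_mul_expand]
  convert zero_mul g
  ext n
  rw [coeff_multisection, coeff_X_pow, if_neg (fun h => hr ⟨n, h.symm⟩), map_zero]

/-- `U₅` extracts the leading component of a 5-dissection. -/
theorem multisection_five_dissection (g₀ g₁ g₂ g₃ g₄ : ℂ⟦X⟧) :
    multisection 5 (expand 5 (by norm_num) g₀ + X ^ 1 * expand 5 (by norm_num) g₁ +
      X ^ 2 * expand 5 (by norm_num) g₂ + X ^ 3 * expand 5 (by norm_num) g₃ +
      X ^ 4 * expand 5 (by norm_num) g₄) = g₀ := by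
  simp only [map_add]
  rw [multisection_X_pow_mul_expand _ (by norm_num), multisection_X_pow_mul_expand _ (by norm_num),
    multisection_X_pow_mul_expand _ (by norm_num), multisection_X_pow_mul_expand _ (by norm_num)]
  simp only [add_zero]
  ext n
  rw [coeff_multisection, coeff_expand_mul]

/-- The 5-dissection `ψ(q) = f(q¹⁰,q¹⁵) + q f(q⁵,q²⁰) + q³ ψ(q²⁵)`. -/
theorem psi_dissection :
    psi = expand 5 (by norm_num) (theta 3 5) + X * expand 5 (by norm_num) (theta 4 5) +
      X ^ 3 * expand 5 (by norm_num) (expand 5 (by norm_num) psi) := by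
  have h := theta_one_one_dissection
  rw [theta_one_one, theta_mul_self 25 (by norm_num)] at h
  rw [expand_theta 5 3 5 (by norm_num) (by norm_num) (by norm_num),
    expand_theta 5 4 5 (by norm_num) (by norm_num) (by norm_num),
    ← expand_mul 5 (by norm_num) 5 (by norm_num)]
  refine mul_left_cancel₀ (natCast_ne_zero two_ne_zero) ?_
  push_cast
  linear_combination h

/-- The quotient of the norm of `a + b + c` by `a + b + c`, where the norm is the product of the
`a + ζ b + ζ³ c` over the fifth roots of unity `ζ`. -/
def conormFive {R : Type*} [CommRing R] (a b c : R) : R :=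
  a ^ 4 - a ^ 3 * b - a ^ 3 * c + a ^ 2 * b ^ 2 + 2 * a ^ 2 * b * c + a ^ 2 * c ^ 2 - a * b ^ 3 +
    2 * a * b ^ 2 * c - 3 * a * b * c ^ 2 - a * c ^ 3 + b ^ 4 - b ^ 3 * c + b ^ 2 * c ^ 2 -
    b * c ^ 3 + c ^ 4

/-- The four factors pair up to polynomials in the Gaussian periods `z + z⁴` and `z² + z³`, whose
sum and product are `-1`. -/
theorem prod_eq_conormFive {R : Type*} [CommRing R] (a b c z : R)
    (hs : 1 + z + z ^ 2 + z ^ 3 + z ^ 4 = 0) :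
    (a + z * b + z ^ 3 * c) * (a + z ^ 2 * b + z * c) * (a + z ^ 3 * b + z ^ 4 * c) *
      (a + z ^ 4 * b + z ^ 2 * c) = conormFive a b c := by
  have hz : z ^ 5 = 1 := by linear_combination (z - 1) * hs
  have h1 : (a + z * b + z ^ 3 * c) * (a + z ^ 4 * b + z ^ 2 * c) =
      a ^ 2 + b ^ 2 + c ^ 2 + (z + z ^ 4) * (a * b) + (z ^ 2 + z ^ 3) * (a * c + b * c) := by
    linear_combination (b ^ 2 + b * c * z ^ 2 + c ^ 2) * hz
  have h2 : (a + z ^ 2 * b + z * c) * (a + z ^ 3 * b + z ^ 4 * c) =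
      a ^ 2 + b ^ 2 + c ^ 2 + (z ^ 2 + z ^ 3) * (a * b) + (z + z ^ 4) * (a * c + b * c) := by
    linear_combination (b ^ 2 + b * c * z + c ^ 2) * hz
  have h3 : (z + z ^ 4) + (z ^ 2 + z ^ 3) = -1 := by linear_combination hs
  have h4 : (z + z ^ 4) * (z ^ 2 + z ^ 3) = -1 := by
    linear_combination hs + (z + z ^ 2) * hz
  rw [show (a + z * b + z ^ 3 * c) * (a + z ^ 2 * b + z * c) * (a + z ^ 3 * b + z ^ 4 * c) *
      (a + z ^ 4 * b + z ^ 2 * c) = ((a + z * b + z ^ 3 * c) * (a + z ^ 4 * b + z ^ 2 * c)) *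
      ((a + z ^ 2 * b + z * c) * (a + z ^ 3 * b + z ^ 4 * c)) by ring, h1, h2]
  generalize z + z ^ 4 = s at h3 h4 ⊢
  generalize z ^ 2 + z ^ 3 = t at h3 h4 ⊢
  rw [conormFive]
  linear_combination ((a ^ 2 + b ^ 2 + c ^ 2) * (a * b + a * c + b * c) +
    a * b * (a * c + b * c) * (s + t - 1)) * h3 + (a * b - (a * c + b * c)) ^ 2 * h4

/-- The norm of `ψ(q)`, expressed through its 5-dissection, equals `ψ(q⁵)⁶ / ψ(q²⁵)`. -/
theorem psi_mul_conormFive :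
    psi * conormFive (expand 5 (by norm_num) (theta 3 5)) (X * expand 5 (by norm_num) (theta 4 5))
      (X ^ 3 * expand 5 (by norm_num) (expand 5 (by norm_num) psi)) *
      expand 5 (by norm_num) (expand 5 (by norm_num) psi) = expand 5 (by norm_num) psi ^ 6 := by
  obtain ⟨ω, hω⟩ : ∃ ω : ℂ, IsPrimitiveRoot ω 5 := ⟨_, Complex.isPrimitiveRoot_exp 5 (by norm_num)⟩
  have hN := normFive_psi hω
  have hs : (1 + C ω + C ω ^ 2 + C ω ^ 3 + C ω ^ 4 : ℂ⟦X⟧) = 0 := by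
    simpa using congrArg (C : ℂ → ℂ⟦X⟧) (sum_pow_eq_zero hω)
  have hz : (C ω ^ 5 : ℂ⟦X⟧) = 1 := by rw [← map_pow, hω.pow_eq_one, map_one]
  have he : expand 25 (by norm_num) psi = expand 5 (by norm_num) (expand 5 (by norm_num) psi) :=
    expand_mul 5 (by norm_num) 5 (by norm_num) psi
  rw [he] at hN
  have hr (j : ℕ) : rescale (ω ^ j) psi =
      expand 5 (by norm_num) (theta 3 5) + C ω ^ j * (X * expand 5 (by norm_num) (theta 4 5)) +
      (C ω ^ j) ^ 3 * (X ^ 3 * expand 5 (by norm_num) (expand 5 (by norm_num) psi)) := by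
    have h1 : (ω ^ j) ^ 5 = 1 := by rw [← pow_mul, mul_comm, pow_mul, hω.pow_eq_one, one_pow]
    conv_lhs => rw [psi_dissection]
    simp only [map_add, map_mul, map_pow, rescale_expand, h1, rescale_one, rescale_X, RingHom.id_apply]
    ring
  have hr1 := hr 1
  rw [pow_one] at hr1
  rw [← hN, normFive, hr1, hr, hr, hr]
  set a := expand 5 (by norm_num) (theta 3 5)
  set b := X * expand 5 (by norm_num) (theta 4 5)
  set e := expand 5 (by norm_num) (expand 5 (by norm_num) psi)
  set z : ℂ⟦X⟧ := C ω
  have e1 : (z ^ 2) ^ 3 = z := by linear_combination z * hz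
  have e2 : (z ^ 3) ^ 3 = z ^ 4 := by linear_combination z ^ 4 * hz
  have e3 : (z ^ 4) ^ 3 = z ^ 2 := by linear_combination (z ^ 7 + z ^ 2) * hz
  rw [← prod_eq_conormFive a b (X ^ 3 * e) z hs, e1, e2, e3]
  ring

/-- The series `W = q³ ψ(q⁵)⁵ / ψ(q)`. The shift by `q³` makes it an eta quotient
(an Eisenstein series), annihilated by `(U₅ - 1)(U₅ - 5)`. -/
noncomputable def psiQuotient : ℂ⟦X⟧ := X ^ 3 * expand 5 (by norm_num) psi ^ 5 * psi⁻¹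

theorem psiQuotient_mul_psi : psiQuotient * psi = X ^ 3 * expand 5 (by norm_num) psi ^ 5 := by
  rw [psiQuotient, mul_assoc, PowerSeries.inv_mul_cancel _ (by simp [constantCoeff_psi]), mul_one]

/-- The monomials of `q³ · conormFive` with exponent of `q` divisible by 5 are those in
`a²b²`, `abc²` and `c⁴`. -/
theorem multisection_conormFive (A B P : ℂ⟦X⟧) :
    multisection 5 (X ^ 3 * conormFive (expand 5 (by norm_num) A)
      (X * expand 5 (by norm_num) B) (X ^ 3 * expand 5 (by norm_num) P)) =
      A ^ 2 * B ^ 2 * X - 3 * A * B * P ^ 2 * X ^ 2 + P ^ 4 * X ^ 3 := by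
  rw [← multisection_five_dissection (A ^ 2 * B ^ 2 * X - 3 * A * B * P ^ 2 * X ^ 2 + P ^ 4 * X ^ 3)
    (- A ^ 3 * P * X - A * B ^ 3 * X + B ^ 2 * P ^ 2 * X ^ 2)
    (2 * A ^ 2 * B * P * X - A * P ^ 3 * X ^ 2 + B ^ 4 * X)
    (A ^ 4 + 2 * A * B ^ 2 * P * X - B * P ^ 3 * X ^ 2)
    (- A ^ 3 * B + A ^ 2 * P ^ 2 * X - B ^ 3 * P * X)]
  congr 1
  simp only [map_add, map_sub, map_mul, map_pow, map_neg, map_ofNat, expand_X, conormFive]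
  generalize expand 5 _ A = a, expand 5 _ B = b, expand 5 _ P = c
  ring

theorem psiQuotient_mul_expand_psi :
    psiQuotient * expand 5 (by norm_num) psi =
      X ^ 3 * conormFive (expand 5 (by norm_num) (theta 3 5))
        (X * expand 5 (by norm_num) (theta 4 5))
        (X ^ 3 * expand 5 (by norm_num) (expand 5 (by norm_num) psi)) *
          expand 5 (by norm_num) (expand 5 (by norm_num) psi) := by
  have hW := psiQuotient_mul_psi
  have hN := psi_mul_conormFive
  have h0 : expand 5 (by norm_num) psi ≠ 0 := expand_ne_zero _ constantCoeff_psi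
  generalize conormFive (R := ℂ⟦X⟧) _ _ _ = M at hN ⊢
  generalize expand 5 _ (expand 5 _ psi) = R at hN ⊢
  generalize expand 5 _ psi = P at *
  refine mul_left_cancel₀ (pow_ne_zero 5 h0) ?_
  rw [show P ^ 5 * (psiQuotient * P) = psiQuotient * P ^ 6 by ring, ← hN]
  linear_combination (M * R) * hW

theorem multisection_psiQuotient :
    multisection 5 psiQuotient = X * psi ^ 3 * expand 5 (by norm_num) psi -
      5 * (X ^ 2 * psi * expand 5 (by norm_num) psi ^ 3) + 5 * psiQuotient := by
  have hW := psiQuotient_mul_psi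
  have hAB := psi_sq
  have h2 := congrArg (multisection 5) psiQuotient_mul_expand_psi
  rw [multisection_mul_expand, multisection_mul_expand, multisection_conormFive] at h2
  generalize multisection 5 psiQuotient = U at h2 ⊢
  generalize expand 5 _ psi = P at *
  generalize theta 3 5 = A at *
  generalize theta 4 5 = B at *
  refine mul_right_cancel₀ psi_ne_zero ?_
  rw [h2]
  linear_combination (-X * P * (psi ^ 2 + A * B - 4 * X * P ^ 2)) * hAB - 5 * hW

theorem multisection_X_psi_pow_three :
    multisection 5 (X * psi ^ 3 * expand 5 (by norm_num) psi) =
      6 * (X * psi ^ 3 * expand 5 (by norm_num) psi) -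
        5 * (X ^ 2 * psi * expand 5 (by norm_num) psi ^ 3) := by
  have hAB := psi_sq
  rw [multisection_mul_expand]
  set P₅ := expand 5 (by norm_num) psi with hP₅
  set A := theta 3 5
  set B := theta 4 5
  have h3 : multisection 5 (X * psi ^ 3) = 6 * A * B * P₅ * X + P₅ ^ 3 * X ^ 2 := by
    rw [← multisection_five_dissection (6 * A * B * P₅ * X + P₅ ^ 3 * X ^ 2)
      (A ^ 3 + 3 * B ^ 2 * P₅ * X) (3 * A ^ 2 * B + 3 * A * P₅ ^ 2 * X)
      (3 * A * B ^ 2 + 3 * B * P₅ ^ 2 * X) (3 * A ^ 2 * P₅ + B ^ 3)]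
    congr 1
    conv_lhs => rw [psi_dissection]
    simp only [map_add, map_mul, map_pow, map_ofNat, expand_X]
    ring
  rw [h3]
  linear_combination (-6 * X * psi * P₅) * hAB

theorem multisection_X_sq_psi :
    multisection 5 (X ^ 2 * psi * expand 5 (by norm_num) psi ^ 3) =
      X * psi ^ 3 * expand 5 (by norm_num) psi := by
  rw [← map_pow, multisection_mul_expand]
  set P₅ := expand 5 (by norm_num) psi with hP₅
  have h3 : multisection 5 (X ^ 2 * psi) = P₅ * X := by
    rw [← multisection_five_dissection (P₅ * X) 0 (theta 3 5) (theta 4 5) 0]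
    congr 1
    conv_lhs => rw [psi_dissection]
    simp only [map_zero, map_mul, expand_X]
    ring
  rw [h3]
  ring

/-- The quadratic relation `(U₅ - 1)(U₅ - 5) = 0` on `q³ ψ(q⁵)⁵ / ψ(q)`. -/
theorem multisection_multisection_psiQuotient :
    multisection 5 (multisection 5 psiQuotient) =
      6 * multisection 5 psiQuotient - 5 * psiQuotient := by
  have h (f : ℂ⟦X⟧) : multisection 5 (5 * f) = 5 * multisection 5 f := by
    rw [← map_ofNat (C (R := ℂ)) 5, ← smul_eq_C_mul, map_smul, smul_eq_C_mul]
  conv_lhs => rw [multisection_psiQuotient]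
  rw [map_add, map_sub, h, h, multisection_X_psi_pow_three, multisection_X_sq_psi,
    multisection_psiQuotient]
  ring

theorem coeff_psiQuotient_rec (n : ℕ) :
    coeff (25 * n) psiQuotient = 6 * coeff (5 * n) psiQuotient - 5 * coeff n psiQuotient := by
  have h := congrArg (coeff n) multisection_multisection_psiQuotient
  have h6 : (6 : ℂ⟦X⟧) = C 6 := (map_ofNat C 6).symm
  have h5 : (5 : ℂ⟦X⟧) = C 5 := (map_ofNat C 5).symm
  rw [h6, h5, map_sub, coeff_C_mul, coeff_C_mul] at h
  simp only [coeff_multisection, ← mul_assoc] at h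
  exact h

/-- The solution of the recurrence. Two consecutive values of the exponent are needed for the
induction; the first is also valid for `k = 0` and `k = 1`. -/
theorem coeff_five_pow_mul_psiQuotient (n k : ℕ) :
    coeff (5 ^ k * n) psiQuotient =
      (5 ^ k - 1) / 4 * coeff (5 * n) psiQuotient - (5 ^ k - 5) / 4 * coeff n psiQuotient ∧
    coeff (5 ^ (k + 1) * n) psiQuotient =
      (5 ^ (k + 1) - 1) / 4 * coeff (5 * n) psiQuotient -
        (5 ^ (k + 1) - 5) / 4 * coeff n psiQuotient := by
  induction k with
  | zero => constructor <;> norm_num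
  | succ k ih =>
    refine ⟨ih.2, ?_⟩
    have h := coeff_psiQuotient_rec (5 ^ k * n)
    rw [show 25 * (5 ^ k * n) = 5 ^ (k + 1 + 1) * n by ring,
      show 5 * (5 ^ k * n) = 5 ^ (k + 1) * n by ring, ih.1, ih.2] at h
    rw [h]
    ring

/-! ### The 2-dissection of `q³ ψ(q⁵)⁵ / ψ(q)` -/

theorem rescale_ne_zero (a : ℂ) {f : ℂ⟦X⟧} (h : constantCoeff f = 1) : rescale a f ≠ 0 :=
  fun h0 => by
    have h1 := coeff_rescale f a 0
    rw [h0, coeff_zero_eq_constantCoeff_apply, coeff_zero_eq_constantCoeff_apply, h] at h1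
    simp at h1

theorem rescale_neg_one_expand_odd {d : ℕ} (hd : Odd d) (f : ℂ⟦X⟧) :
    rescale (-1) (expand d hd.pos.ne' f) = expand d hd.pos.ne' (rescale (-1) f) := by
  rw [rescale_expand, hd.neg_one_pow]

theorem rescale_neg_one_expand_even {d : ℕ} (hd : Even d) (hd' : d ≠ 0) (f : ℂ⟦X⟧) :
    rescale (-1) (expand d hd' f) = expand d hd' f := by
  rw [rescale_expand, hd.neg_one_pow, rescale_one, RingHom.id_apply]

theorem euler_eq_expand {d : ℕ} (hd : d ≠ 0) : euler d = expand d hd (euler 1) := by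
  rw [expand_euler d 1 hd one_ne_zero, mul_one]

theorem rescale_neg_one_euler_even {d : ℕ} (hd : Even d) (hd' : d ≠ 0) :
    rescale (-1) (euler d) = euler d := by
  rw [euler_eq_expand hd', rescale_neg_one_expand_even hd hd']

/-- The relation `φ(-q)² = φ(-q⁵)² (1 - 4u)`, cleared of denominators, where
`u = q E₁₀⁵ E₁ / (E₅⁵ E₂)`. -/
theorem euler_relation_phi_neg :
    euler 1 ^ 4 * euler 10 ^ 2 * euler 5 + 4 * X * euler 10 ^ 5 * euler 1 * euler 2 =
      euler 5 ^ 5 * euler 2 ^ 2 := by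
  have h := congrArg (rescale (-1)) euler_relation_phi
  have h1 := euler_one_mul_rescale_neg_one
  have h5 := congrArg (expand 5 (by norm_num)) h1
  have r5 : rescale (-1) (euler 5) = expand 5 (by norm_num) (rescale (-1) (euler 1)) := by
    rw [euler_eq_expand (by norm_num : 5 ≠ 0), rescale_neg_one_expand_odd (by decide)]
  have rX : rescale (-1) (X : ℂ⟦X⟧) = -X := by rw [rescale_X]; simp
  simp only [map_add, map_mul, map_pow, rX, map_ofNat,
    rescale_neg_one_euler_even (by decide : Even 2) two_ne_zero,
    rescale_neg_one_euler_even (by decide : Even 20) (by norm_num : 20 ≠ 0),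
    rescale_neg_one_euler_even (by decide : Even 10) (by norm_num : 10 ≠ 0),
    rescale_neg_one_euler_even (by decide : Even 4) (by norm_num : 4 ≠ 0), r5] at h
  simp only [map_mul, map_pow, expand_euler 5 4 (by norm_num) (by norm_num),
    expand_euler 5 1 (by norm_num) (by norm_num), expand_euler 5 2 (by norm_num) (by norm_num),
    Nat.reduceMul] at h5
  have n1 := euler_ne_zero (one_ne_zero : 1 ≠ 0)
  have n2 := euler_ne_zero (two_ne_zero : 2 ≠ 0)
  have n5 := euler_ne_zero (by norm_num : 5 ≠ 0)
  have n10 := euler_ne_zero (by norm_num : 10 ≠ 0)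
  generalize expand 5 _ (rescale (-1) (euler 1)) = f at *
  generalize rescale (-1) (euler 1) = e at *
  generalize euler 1 = e1 at *
  generalize euler 2 = e2 at *
  generalize euler 4 = e4 at *
  generalize euler 5 = e5 at *
  generalize euler 10 = e10 at *
  generalize euler 20 = e20 at *
  refine mul_left_cancel₀ (mul_ne_zero (pow_ne_zero 10 n2) (pow_ne_zero 10 n10)) ?_
  calc e2 ^ 10 * e10 ^ 10 * (e1 ^ 4 * e10 ^ 2 * e5 + 4 * X * e10 ^ 5 * e1 * e2)
      = e2 ^ 10 * (e10 ^ 3) ^ 4 * e1 ^ 4 * e5 +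
        4 * X * e2 ^ 2 * (e10 ^ 3) ^ 5 * (e2 ^ 3) ^ 3 * e1 := by ring
    _ = e1 ^ 4 * e5 ^ 5 * (e2 ^ 10 * e20 ^ 4 * f ^ 4) +
        4 * X * e2 ^ 2 * e20 ^ 5 * f ^ 5 * e4 ^ 3 * e ^ 3 * e1 ^ 4 * e5 ^ 5 := by
      rw [← h5, ← h1]; ring
    _ = e10 ^ 10 * (e1 * e * e4) ^ 4 * e5 ^ 5 := by rw [h]; ring
    _ = e2 ^ 10 * e10 ^ 10 * (e5 ^ 5 * e2 ^ 2) := by rw [h1]; ring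

/-- The algebra behind the 2-dissection. With `u = q e₁₀⁵ e₁ / (e₅⁵ e₂)`, `u'` its value at `-q` and
`w` its value at `q²`, the hypotheses give `u u' = -w` and `(1 + u)(1 + u') = (1 + w)(1 - 4w)`,
hence `u + u' = -2w(1 + 2w)`, which is the conclusion. -/
theorem two_dissection_identity {K : Type*} [Field K] {q e1 f1 e2 e4 e5 f5 e10 e20 : K}
    (n1 : e1 ≠ 0) (n2 : e2 ≠ 0) (n4 : e4 ≠ 0) (n5 : e5 ≠ 0) (n10 : e10 ≠ 0) (n20 : e20 ≠ 0)
    (m1 : f1 ≠ 0) (m5 : f5 ≠ 0)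
    (h1 : e1 * f1 * e4 = e2 ^ 3) (h5 : e5 * f5 * e20 = e10 ^ 3)
    (ha : e2 ^ 4 * e5 ^ 2 * e10 = q * e10 ^ 5 * e1 ^ 2 + e5 ^ 5 * e2 * e1)
    (ha' : e2 ^ 4 * f5 ^ 2 * e10 = -q * e10 ^ 5 * f1 ^ 2 + f5 ^ 5 * e2 * f1)
    (ha2 : e4 ^ 4 * e10 ^ 2 * e20 = q ^ 2 * e20 ^ 5 * e2 ^ 2 + e10 ^ 5 * e4 * e2)
    (hb : e2 ^ 4 * e20 ^ 2 * e10 + 4 * q ^ 2 * e20 ^ 5 * e2 * e4 = e10 ^ 5 * e4 ^ 2) :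
    q ^ 3 * (e10 ^ 2 / e5) ^ 5 / (e2 ^ 2 / e1) - q ^ 3 * (e10 ^ 2 / f5) ^ 5 / (e2 ^ 2 / f1) =
      -2 * (q ^ 4 * (e4 ^ 2 / e2) * (e20 ^ 2 / e10) ^ 3 +
        q ^ 6 * (e20 ^ 2 / e10) ^ 5 / (e4 ^ 2 / e2)) := by
  set u := q * e10 ^ 5 * e1 / (e5 ^ 5 * e2) with hu
  set u' := -q * e10 ^ 5 * f1 / (f5 ^ 5 * e2) with hu'
  set w := q ^ 2 * e20 ^ 5 * e2 / (e10 ^ 5 * e4) with hw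
  set G := q ^ 2 * e10 ^ 5 / e2 with hG
  have i1 : 1 + u = e2 ^ 3 * e10 / (e1 * e5 ^ 3) := by
    rw [hu]; field_simp; linear_combination -ha
  have i2 : 1 + u' = e2 ^ 3 * e10 / (f1 * f5 ^ 3) := by
    rw [hu']; field_simp; linear_combination -ha'
  have i3 : 1 + w = e4 ^ 3 * e20 / (e2 * e10 ^ 3) := by
    rw [hw]; field_simp; linear_combination -ha2
  have i4 : 1 - 4 * w = e2 ^ 4 * e20 ^ 2 / (e4 ^ 2 * e10 ^ 4) := by
    rw [hw]; field_simp; linear_combination -hb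
  have hf1 : f1 = e2 ^ 3 / (e1 * e4) := by field_simp; linear_combination h1
  have hf5 : f5 = e10 ^ 3 / (e5 * e20) := by field_simp; linear_combination h5
  have p1 : u * u' = -w := by
    rw [hu, hu', hw, hf1, hf5]; field_simp
  have p2 : (1 + u) * (1 + u') = (1 + w) * (1 - 4 * w) := by
    rw [i1, i2, i3, i4, hf1, hf5]; field_simp
  have p3 : u + u' = -2 * w * (1 + 2 * w) := by linear_combination p2 - p1
  have l1 : q ^ 3 * (e10 ^ 2 / e5) ^ 5 / (e2 ^ 2 / e1) = G * u := by
    rw [hG, hu]; field_simp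
  have l2 : q ^ 3 * (e10 ^ 2 / f5) ^ 5 / (e2 ^ 2 / f1) = -(G * u') := by
    rw [hG, hu']; field_simp
  have l3 : q ^ 4 * (e4 ^ 2 / e2) * (e20 ^ 2 / e10) ^ 3 = G * w * (1 + w) := by
    rw [i3, hG, hw]; field_simp
  have l4 : q ^ 6 * (e20 ^ 2 / e10) ^ 5 / (e4 ^ 2 / e2) = G * w * w := by
    rw [hG, hw]; field_simp
  rw [l1, l2, l3, l4]
  linear_combination G * p3

/-- The difference `q² ψ(q) ψ(q⁵)³ - q³ ψ(q⁵)⁵ / ψ(q)` is the even function `q² E₁₀⁵ / E₂`. -/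
theorem exists_expand_two_eq :
    ∃ g : ℂ⟦X⟧, X ^ 2 * psi * expand 5 (by norm_num) psi ^ 3 - psiQuotient =
      expand 2 (by norm_num) g := by
  refine ⟨X * euler 5 ^ 5 * (euler 1)⁻¹, ?_⟩
  have hi := congrArg (expand 2 (by norm_num)) (PowerSeries.mul_inv_cancel (euler 1)
    (by simp [constantCoeff_euler one_ne_zero]))
  simp only [map_mul, map_pow, expand_X, expand_euler 2 5 (by norm_num) (by norm_num),
    expand_euler 2 1 (by norm_num) (by norm_num), map_one, Nat.reduceMul] at hi ⊢
  have hW := psiQuotient_mul_psi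
  have h1 := psi_mul_euler
  have h5 := psi_five_mul_euler
  have hAB := psi_sq
  have hT := theta_three_five_mul_theta_four_five
  have ne : psi * (euler 2 * euler 10 * euler 1 * euler 5 ^ 3) ≠ 0 := by
    exact mul_ne_zero psi_ne_zero (mul_ne_zero (mul_ne_zero (mul_ne_zero
      (euler_ne_zero two_ne_zero) (euler_ne_zero (by norm_num))) (euler_ne_zero one_ne_zero))
      (pow_ne_zero 3 (euler_ne_zero (by norm_num))))
  refine mul_right_cancel₀ ne ?_
  generalize theta 3 5 * theta 4 5 = T at *
  generalize expand 5 _ psi = P at *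
  generalize expand 2 _ (euler 1)⁻¹ = I at *
  calc (X ^ 2 * psi * P ^ 3 - psiQuotient) * (psi * (euler 2 * euler 10 * euler 1 * euler 5 ^ 3))
      = X ^ 2 * (P * euler 5) ^ 3 * (T * (euler 10 * euler 1)) * euler 2 := by
        linear_combination (X ^ 2 * P ^ 3 * euler 5 ^ 3 * euler 10 * euler 1 * euler 2) * hAB -
          (euler 2 * euler 10 * euler 1 * euler 5 ^ 3) * hW
    _ = X ^ 2 * euler 10 ^ 6 * euler 5 ^ 3 * euler 2 ^ 2 * (euler 2 * I) := by
        rw [h5, hT, hi]; ring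
    _ = X ^ 2 * euler 10 ^ 5 * I * (psi * (euler 2 * euler 10 * euler 1 * euler 5 ^ 3)) := by
        rw [← h1]; ring

/-- `W(q) + W(-q) = -2 (q² ψ(q) ψ(q⁵)³ + W)(q²)`, which determines `U₂ W`. -/
theorem psiQuotient_add_rescale :
    psiQuotient + rescale (-1) psiQuotient =
      -2 * expand 2 (by norm_num) (X ^ 2 * psi * expand 5 (by norm_num) psi ^ 3 + psiQuotient) := by
  have rX : rescale (-1) (X : ℂ⟦X⟧) = -X := by rw [rescale_X]; simp
  have r2 := rescale_neg_one_euler_even (by decide : Even 2) two_ne_zero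
  have r10 := rescale_neg_one_euler_even (by decide : Even 10) (by norm_num : 10 ≠ 0)
  have x (c : ℕ) (hc : c ≠ 0) := expand_euler 2 c (by norm_num) hc
  have h1 := euler_one_mul_rescale_neg_one
  have h5 := congrArg (expand 5 (by norm_num)) h1
  rw [map_mul, map_mul, map_pow, ← rescale_neg_one_expand_odd (by decide : Odd 5),
    expand_euler 5 1 _ (by norm_num), expand_euler 5 4 _ (by norm_num),
    expand_euler 5 2 _ (by norm_num)] at h5
  have ha := euler_relation_psi
  have ha' := congrArg (rescale (-1)) ha
  have ha2 := congrArg (expand 2 (by norm_num)) ha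
  have hb := congrArg (expand 2 (by norm_num)) euler_relation_phi_neg
  have p1 := psi_mul_euler
  have p5 := psi_five_mul_euler
  have p1' := congrArg (rescale (-1)) p1
  have p5' := congrArg (rescale (-1)) p5
  have p2 := congrArg (expand 2 (by norm_num)) p1
  have p10 := congrArg (expand 2 (by norm_num)) p5
  have hW := psiQuotient_mul_psi
  have hW' := congrArg (rescale (-1)) hW
  have hW2 := congrArg (expand 2 (by norm_num)) hW
  have ne2 : expand 2 (by norm_num) psi ≠ 0 := expand_ne_zero _ constantCoeff_psi
  have ne1' : rescale (-1) psi ≠ 0 := rescale_ne_zero _ constantCoeff_psi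
  have m1 : rescale (-1) (euler 1) ≠ 0 := rescale_ne_zero _ (constantCoeff_euler one_ne_zero)
  have m5 : rescale (-1) (euler 5) ≠ 0 := rescale_ne_zero _ (constantCoeff_euler (by norm_num))
  simp only [map_mul, map_pow, map_add, map_ofNat, rX, r2, r10, expand_X, x 1 one_ne_zero,
    x 2 two_ne_zero, x 5 (by norm_num), x 10 (by norm_num), Nat.reduceMul]
    at h5 ha' ha2 hb p1' p5' p2 p10 hW' hW2 ⊢
  have n1 := euler_ne_zero (one_ne_zero : 1 ≠ 0)
  have n2 := euler_ne_zero (two_ne_zero : 2 ≠ 0)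
  have n4 := euler_ne_zero (by norm_num : 4 ≠ 0)
  have n5 := euler_ne_zero (by norm_num : 5 ≠ 0)
  have n10 := euler_ne_zero (by norm_num : 10 ≠ 0)
  have n20 := euler_ne_zero (by norm_num : 20 ≠ 0)
  have ne1 := psi_ne_zero
  -- The identity is now purely algebraic, and is checked in the fraction field.
  generalize expand 2 _ (expand 5 _ psi) = P10 at *
  generalize rescale (-1) (expand 5 _ psi) = P5' at *
  generalize expand 5 _ psi = P5 at *
  generalize expand 2 _ psi = P2 at *
  generalize rescale (-1) psi = P1' at *
  generalize expand 2 _ psiQuotient = W2 at *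
  generalize rescale (-1) psiQuotient = W' at *
  generalize psiQuotient = W at *
  generalize psi = P1 at *
  generalize rescale (-1) (euler 1) = f1 at *
  generalize rescale (-1) (euler 5) = f5 at *
  generalize euler 1 = e1, euler 2 = e2, euler 4 = e4, euler 5 = e5, euler 10 = e10,
    euler 20 = e20 at *
  generalize (X : ℂ⟦X⟧) = q at *
  have hinj := IsFractionRing.injective ℂ⟦X⟧ (FractionRing ℂ⟦X⟧)
  have nz {y : ℂ⟦X⟧} (hy : y ≠ 0) : algebraMap ℂ⟦X⟧ (FractionRing ℂ⟦X⟧) y ≠ 0 := fun h =>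
    hy (hinj (h.trans (map_zero _).symm))
  refine hinj ?_
  replace h1 := congrArg (algebraMap ℂ⟦X⟧ (FractionRing ℂ⟦X⟧)) h1
  replace h5 := congrArg (algebraMap ℂ⟦X⟧ (FractionRing ℂ⟦X⟧)) h5
  replace ha := congrArg (algebraMap ℂ⟦X⟧ (FractionRing ℂ⟦X⟧)) ha
  replace ha' := congrArg (algebraMap ℂ⟦X⟧ (FractionRing ℂ⟦X⟧)) ha'
  replace ha2 := congrArg (algebraMap ℂ⟦X⟧ (FractionRing ℂ⟦X⟧)) ha2
  replace hb := congrArg (algebraMap ℂ⟦X⟧ (FractionRing ℂ⟦X⟧)) hb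
  replace p1 := congrArg (algebraMap ℂ⟦X⟧ (FractionRing ℂ⟦X⟧)) p1
  replace p5 := congrArg (algebraMap ℂ⟦X⟧ (FractionRing ℂ⟦X⟧)) p5
  replace p1' := congrArg (algebraMap ℂ⟦X⟧ (FractionRing ℂ⟦X⟧)) p1'
  replace p5' := congrArg (algebraMap ℂ⟦X⟧ (FractionRing ℂ⟦X⟧)) p5'
  replace p2 := congrArg (algebraMap ℂ⟦X⟧ (FractionRing ℂ⟦X⟧)) p2
  replace p10 := congrArg (algebraMap ℂ⟦X⟧ (FractionRing ℂ⟦X⟧)) p10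
  replace hW := congrArg (algebraMap ℂ⟦X⟧ (FractionRing ℂ⟦X⟧)) hW
  replace hW' := congrArg (algebraMap ℂ⟦X⟧ (FractionRing ℂ⟦X⟧)) hW'
  replace hW2 := congrArg (algebraMap ℂ⟦X⟧ (FractionRing ℂ⟦X⟧)) hW2
  replace n1 := nz n1
  replace n2 := nz n2
  replace n4 := nz n4
  replace n5 := nz n5
  replace n10 := nz n10
  replace n20 := nz n20
  replace m1 := nz m1
  replace m5 := nz m5
  replace ne1 := nz ne1
  replace ne1' := nz ne1'
  replace ne2 := nz ne2
  simp only [map_mul, map_pow, map_add, map_neg, map_ofNat] at *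
  generalize algebraMap ℂ⟦X⟧ (FractionRing ℂ⟦X⟧) = ι at *
  have key := two_dissection_identity (q := ι q) n1 n2 n4 n5 n10 n20 m1 m5 h1 h5 ha ha' ha2 hb
  rw [← eq_div_iff n1] at p1
  rw [← eq_div_iff n5] at p5
  rw [← eq_div_iff m1] at p1'
  rw [← eq_div_iff m5] at p5'
  rw [← eq_div_iff n2] at p2
  rw [← eq_div_iff n10] at p10
  rw [← eq_div_iff ne1] at hW
  rw [← eq_div_iff ne1'] at hW'
  rw [← eq_div_iff ne2] at hW2
  rw [hW, hW', hW2, p1, p5, p1', p5', p2, p10]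
  linear_combination key

theorem coeff_two_mul_psiQuotient {m : ℕ} (hm : Odd m) :
    coeff (2 * m) psiQuotient = -2 * coeff m psiQuotient := by
  obtain ⟨g, hg⟩ := exists_expand_two_eq
  have h1 := congrArg (coeff m) hg
  rw [coeff_expand_of_not_dvd 2 (by norm_num) _ hm.not_two_dvd_nat, map_sub] at h1
  have h2 := congrArg (coeff (2 * m)) psiQuotient_add_rescale
  have hC : (-2 : ℂ⟦X⟧) = C (-2) := by rw [map_neg, map_ofNat]
  rw [hC, coeff_C_mul, coeff_expand_mul, map_add, map_add, coeff_rescale,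
    (even_two_mul m).neg_one_pow] at h2
  linear_combination h2 / 2 - h1

/-! ### Return to `b̄₅` -/

/-- The sign comes from the passage from `q` to `-q`. -/
theorem coeff_psiQuotient (n : ℕ) :
    coeff (n + 3) psiQuotient = (-1) ^ n * (bBarFive n : ℂ) := by
  have hneg : PowerSeries.map (Int.castRingHom ℂ) thetaPsiNeg = rescale (-1) psi := by
    ext n
    simp [thetaPsiNeg, psi, coeff_rescale]
  have h := congrArg (PowerSeries.map (Int.castRingHom ℂ)) bBarFiveSeries_mul_thetaPsiNeg
  rw [map_mul, map_pow, map_expand, hneg] at h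
  have h' := congrArg (rescale (-1)) h
  rw [map_mul, map_pow, rescale_neg_one_expand_odd (by decide), rescale_rescale] at h'
  norm_num [rescale_one] at h'
  have hq : psiQuotient = X ^ 3 * rescale (-1) (PowerSeries.map (Int.castRingHom ℂ) bBarFiveSeries) := by
    refine mul_right_cancel₀ psi_ne_zero ?_
    rw [psiQuotient_mul_psi, mul_assoc, h']
  rw [hq, coeff_X_pow_mul, coeff_rescale, coeff_map, bBarFive]
  rfl

end ThetaQuotient

open ThetaQuotient in
theorem theorem4 :
    (∀ n : ℕ, bBarFive (4 * n + 3) = 2 * bBarFive (2 * n)) ∧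
    (∀ n k : ℕ, 2 ≤ k →
      (bBarFive (5 ^ k * (n + 3) - 3) : ℚ) =
        ((5 : ℚ) ^ k - 1) / 4 * (bBarFive (5 * n + 12) : ℚ) -
          ((5 : ℚ) ^ k - 5) / 4 * (bBarFive n : ℚ)) := by
  constructor
  · intro n
    have h := coeff_two_mul_psiQuotient (m := 2 * n + 3) ⟨n + 1, by ring⟩
    rw [show 2 * (2 * n + 3) = (4 * n + 3) + 3 by ring, coeff_psiQuotient, coeff_psiQuotient,
      (even_two_mul n).neg_one_pow, Odd.neg_one_pow ⟨2 * n + 1, by ring⟩] at h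
    have h' : (bBarFive (4 * n + 3) : ℂ) = ((2 * bBarFive (2 * n) : ℤ) : ℂ) := by
      push_cast
      linear_combination -h
    exact_mod_cast h'
  · intro n k _
    have h := (coeff_five_pow_mul_psiQuotient (n + 3) k).1
    have hodd : Odd (5 ^ k) := Odd.pow (by decide)
    have hpos : 1 ≤ 5 ^ k := Nat.one_le_pow _ _ (by norm_num)
    obtain ⟨c, hc⟩ := hodd
    have hk : 5 ^ k * (n + 3) = (5 ^ k * (n + 3) - 3) + 3 := by
      have : 3 ≤ 5 ^ k * (n + 3) := by nlinarith
      omega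
    -- the three arguments of `b̄₅` have the same parity, so that the signs cancel
    have hs : (-1 : ℂ) ^ (5 ^ k * (n + 3) - 3) = (-1) ^ n := by
      have : 5 ^ k * (n + 3) - 3 = n + 2 * (c * (n + 3)) := by
        have : 5 ^ k * (n + 3) = 2 * (c * (n + 3)) + n + 3 := by rw [hc]; ring
        omega
      rw [this, pow_add, (even_two_mul _).neg_one_pow, mul_one]
    have hs' : (-1 : ℂ) ^ (5 * n + 12) = (-1) ^ n := by
      rw [show 5 * n + 12 = n + 2 * (2 * n + 6) by ring, pow_add, (even_two_mul _).neg_one_pow,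
        mul_one]
    rw [hk, show 5 * (n + 3) = (5 * n + 12) + 3 by ring, coeff_psiQuotient, coeff_psiQuotient,
      coeff_psiQuotient, hs, hs'] at h
    have h0 : ((-1 : ℂ) ^ n) ≠ 0 := pow_ne_zero _ (by norm_num)
    have h' : (bBarFive (5 ^ k * (n + 3) - 3) : ℂ) = ((5 : ℂ) ^ k - 1) / 4 *
        (bBarFive (5 * n + 12) : ℂ) - ((5 : ℂ) ^ k - 5) / 4 * (bBarFive n : ℂ) := by
      refine mul_left_cancel₀ h0 ?_
      linear_combination h
    exact Rat.cast_injective (α := ℂ) (by push_cast; exact h')
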